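/- **Theorem (Energy identity).** Let $\Omega=\{z\in\mathbb{C}:|z|<1\}$ be the unit disc with boundary $\Gamma$, the unit circle, parametrized counterclockwise by arc length $s$; let $\partial=(\partial_x-i\partial_y)/2$ and $\overline\partial=(\partial_x+i\partial_y)/2$ (weak derivatives). For $p\ge 0$ and $H=L^2(\Omega)$ or $H=H^1(\Omega)$ (complex-valued functions), let $l^{2,p}(\mathbb{N};H)$ be the space of sequences $\mathbf{u}=\langle u_0,u_{-1},u_{-2},\dots\rangle$ with $\sum_{j\ge0}(1+j^2)^p\|u_{-j}\|_{H}^2<\infty$, and write $l^2=l^{2,0}$; the space $l^{2,p}(\mathbb{N};H^{1/2}(\Gamma))$ is defined in the same way. Let $L\langle u_0,u_{-1},u_{-2},\dots\rangle=\langle u_{-1},u_{-2},\dots\rangle$ be the left translation, and let $\langle\mathbf{a},\mathbf{b}\rangle=\sum_{k\ge0}a_{-k}\overline{b_{-k}}$, $\|\mathbf{a}\|_{l_2}^2=\langle\mathbf{a},\mathbf{a}\rangle$, for sequences of complex numbers; both are applied pointwise to sequences of functions, and $\partial,\overline\partial$ act entry by entry. Let $\mathbf{f}\in l^{2,1}(\mathbb{N};L^2(\Omega))$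 and let $B$ be a linear operator that is bounded as a map $l^2(\mathbb{N};L^2(\Omega))\to l^{2,1}(\mathbb{N};L^2(\Omega))$ and as a map $l^2(\mathbb{N};H^1(\Omega))\to l^{2,1}(\mathbb{N};H^1(\Omega))$. If $\mathbf{v}\in l^{2,1/2}(\mathbb{N};H^1(\Omega))$ satisfies $$\overline\partial\mathbf{v}+L^2\partial\mathbf{v}=B\mathbf{v}+\mathbf{f}\quad\text{in }\Omega,$$ then $$\begin{aligned}\int_\Omega\|\partial\mathbf{v}\|_{l_2}^2\,dx={}&-2\int_\Omega\sum_{j=1}^\infty\operatorname{Re}\langle L^{2j}\partial\mathbf{v},L^{2j-2}B\mathbf{v}\rangle\,dx+\int_\Omega\sum_{j=0}^\infty\|L^{2j}B\mathbf{v}\|_{l_2}^2\,dx\\&-2\int_\Omega\sum_{j=1}^\infty\operatorname{Re}\langle L^{2j}\partial\mathbf{v},L^{2j-2}\mathbf{f}\rangle\,dx+2\int_\Omega\sum_{j=0}^\infty\operatorname{Re}\langle L^{2j}B\mathbf{v},L^{2j}\mathbf{f}\rangle\,dx\\&+\int_\Omega\sum_{j=0}^\infty\|L^{2j}\mathbf{f}\|_{l_2}^2\,dx+\frac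 i2\int_\Gamma\sum_{j=0}^\infty\langle L^{2j}\mathbf{v},\partial_sL^{2j}\mathbf{v}\rangle\,ds.\end{aligned}$$ Here all the series and integrals over $\Omega$ converge. In the last term $\mathbf{v}$ stands for its trace on $\Gamma$, which lies in $l^{2,1/2}(\mathbb{N};H^{1/2}(\Gamma))$, $\partial_s$ is the tangential derivative, and the integral over $\Gamma$ is understood entry by entry as the duality pairing of $H^{1/2}(\Gamma)$ with $H^{-1/2}(\Gamma)$: $\int_\Gamma g\,\overline{\partial_s g}\,ds=2\pi\sum_{n\in\mathbb{Z}}(-in)|g_n|^2$ for $g(e^{i\beta})=\sum_n g_ne^{in\beta}$; the resulting series over $j$, over the entries and over $n$ converges absolutely. -/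

import Mathlib

open MeasureTheory Filter Topology Complex ComplexConjugate
open scoped ContDiff ENNReal

noncomputable section

namespace BukhgeimBeltrami

/-- The domain `Ω`: the open unit disc of `ℂ = ℝ²`. -/
abbrev disc : Set ℂ := Metric.ball 0 1

/-- Lebesgue measure `dx` on `Ω`. -/
abbrev discMeasure : Measure ℂ := volume.restrict disc

/-- The complex space `L²(Ω)`. -/
abbrev L2Disc : Type := Lp ℂ 2 discMeasure

/-- The space `l²(ℕ; L²(Ω))`. The entry with index `j` is the mode usually written `u_{-j}`. -/
abbrev SeqL2 : Type := lp (fun _ : ℕ => L2Disc) 2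

/-! ### Weak derivatives, `H¹(Ω)` and the Cauchy-Riemann operators -/

/-- `w` is the weak derivative of `u` in `Ω` in the direction `e` (`e = 1` for `x`, `e = I` for `y`),
tested against smooth functions with compact support in `Ω`. -/
def HasWeakDeriv (e : ℂ) (u w : L2Disc) : Prop :=
  ∀ φ : ℂ → ℂ, ContDiff ℝ ∞ φ → HasCompactSupport φ → tsupport φ ⊆ disc →
    ∫ z in disc, u z * fderiv ℝ φ z e = - ∫ z in disc, w z * φ z

/-- `u ∈ H¹(Ω)`. -/
def IsH1 (u : L2Disc) : Prop :=
  (∃ w, HasWeakDeriv 1 u w) ∧ ∃ w, HasWeakDeriv I u w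

open Classical in
/-- The weak derivative in the direction `e` (zero if there is none in `L²(Ω)`). -/
def weakDeriv (e : ℂ) (u : L2Disc) : L2Disc :=
  if h : ∃ w, HasWeakDeriv e u w then h.choose else 0

/-- `∂ = (∂ₓ - i ∂_y) / 2`. -/
def dz (u : L2Disc) : L2Disc := (1 / 2 : ℂ) • (weakDeriv 1 u - I • weakDeriv I u)

/-- `∂̄ = (∂ₓ + i ∂_y) / 2`. -/
def dzbar (u : L2Disc) : L2Disc := (1 / 2 : ℂ) • (weakDeriv 1 u + I • weakDeriv I u)

/-- The square of the `H¹(Ω)` norm. -/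
def h1NormSq (u : L2Disc) : ℝ := ‖u‖ ^ 2 + ‖weakDeriv 1 u‖ ^ 2 + ‖weakDeriv I u‖ ^ 2

/-! ### The weighted spaces `l^{2,p}(ℕ; L²(Ω))` and `l^{2,p}(ℕ; H¹(Ω))` -/

/-- `u ∈ l^{2,p}(ℕ; L²(Ω))`. -/
def MemSeqL2 (p : ℝ) (u : ℕ → L2Disc) : Prop :=
  Summable fun j : ℕ => (1 + (j : ℝ) ^ 2) ^ p * ‖u j‖ ^ 2

/-- The norm of `l^{2,p}(ℕ; L²(Ω))`. -/
def seqL2Norm (p : ℝ) (u : ℕ → L2Disc) : ℝ :=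
  √(∑' j : ℕ, (1 + (j : ℝ) ^ 2) ^ p * ‖u j‖ ^ 2)

/-- `u ∈ l^{2,p}(ℕ; H¹(Ω))`. -/
def MemSeqH1 (p : ℝ) (u : ℕ → L2Disc) : Prop :=
  (∀ j, IsH1 (u j)) ∧ Summable fun j : ℕ => (1 + (j : ℝ) ^ 2) ^ p * h1NormSq (u j)

/-- The norm of `l^{2,p}(ℕ; H¹(Ω))`. -/
def seqH1Norm (p : ℝ) (u : ℕ → L2Disc) : ℝ :=
  √(∑' j : ℕ, (1 + (j : ℝ) ^ 2) ^ p * h1NormSq (u j))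

/-- `B : l²(ℕ; L²(Ω)) → l^{2,1}(ℕ; L²(Ω))` is bounded. -/
def IsBoundedL2 (B : SeqL2 →ₗ[ℂ] SeqL2) : Prop :=
  ∃ C : ℝ, ∀ u : SeqL2, MemSeqL2 1 (B u) ∧ seqL2Norm 1 (B u) ≤ C * seqL2Norm 0 u

/-- `B : l²(ℕ; H¹(Ω)) → l^{2,1}(ℕ; H¹(Ω))` is bounded. -/
def IsBoundedH1 (B : SeqL2 →ₗ[ℂ] SeqL2) : Prop :=
  ∃ C : ℝ, ∀ u : SeqL2, MemSeqH1 0 u → MemSeqH1 1 (B u) ∧ seqH1Norm 1 (B u) ≤ C * seqH1Norm 0 u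

/-! ### Sequences -/

/-- The left translation `L (u₀, u₁, u₂, …) = (u₁, u₂, …)`; its `n`-th power is `leftShift^[n]`. -/
def leftShift {X : Type*} (u : ℕ → X) : ℕ → X := fun k => u (k + 1)

/-- `∂` applied to each entry of a sequence. -/
def dzSeq (u : ℕ → L2Disc) : ℕ → L2Disc := fun k => dz (u k)

/-- `∂̄` applied to each entry of a sequence. -/
def dzbarSeq (u : ℕ → L2Disc) : ℕ → L2Disc := fun k => dzbar (u k)

/-- The sequence of values at a point `z`. -/
def evalAt (u : ℕ → L2Disc) (z : ℂ) : ℕ → ℂ := fun k => u k z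

/-- The inner product of `l₂`, linear in the first entry. -/
def l2Inner (a b : ℕ → ℂ) : ℂ := ∑' k, a k * conj (b k)

/-- The square of the norm of `l₂`. -/
def l2NormSq (a : ℕ → ℂ) : ℝ := ∑' k, ‖a k‖ ^ 2

/-- The expression `∫_Ω ∑_j F_j dx` makes sense: the series converges almost everywhere in `Ω`
and its sum is integrable. -/
def Converges (F : ℕ → ℂ → ℝ) : Prop :=
  (∀ᵐ z ∂discMeasure, Summable fun j => F j z) ∧
    Integrable (fun z => ∑' j, F j z) discMeasure

/-- `∫_Ω ∑_j F_j dx`. -/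
def integralSum (F : ℕ → ℂ → ℝ) : ℝ := ∫ z in disc, ∑' j, F j z

/-! ### The boundary `Γ` -/

instance two_pi_pos_fact : Fact (0 < 2 * Real.pi) := ⟨Real.two_pi_pos⟩

/-- `L²(Γ)`, the unit circle `Γ` being parametrized by the angle `β ∈ ℝ / 2πℤ`. -/
abbrev L2Circle : Type :=
  Lp ℂ 2 (AddCircle.haarAddCircle : Measure (AddCircle (2 * Real.pi)))

/-- `g` is the trace of `u ∈ H¹(Ω)` on `Γ`: the graph of the continuous extension to `H¹(Ω)` of the
restriction to `Γ` of functions smooth up to the boundary. -/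
def IsTrace (u : L2Disc) (g : L2Circle) : Prop :=
  ∃ φ : ℕ → ℂ → ℂ, (∀ n, ContDiff ℝ ∞ (φ n)) ∧
    Tendsto (fun n => eLpNorm (fun z => φ n z - u z) 2 discMeasure) atTop (𝓝 0) ∧
    (∀ e ∈ ({1, I} : Set ℂ),
      Tendsto (fun n => eLpNorm (fun z => fderiv ℝ (φ n) z e - weakDeriv e u z) 2 discMeasure)
        atTop (𝓝 0)) ∧
    Tendsto (fun n => eLpNorm (fun β => φ n (AddCircle.toCircle β : ℂ) - g β) 2
      AddCircle.haarAddCircle) atTop (𝓝 0)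

/-- The Fourier coefficients of `g`: `g (e^{iβ}) = ∑ₙ gₙ e^{inβ}`. -/
def coeff (g : L2Circle) : ℤ → ℂ := fourierCoeff g

/-- The tangential derivative `∂_s` of a distribution on `Γ`, in terms of Fourier coefficients. -/
def tangentialDeriv (a : ℤ → ℂ) : ℤ → ℂ := fun n => I * n * a n

/-- The duality pairing `∫_Γ g \bar h ds` of `H^{1/2}(Γ)` and `H^{-1/2}(Γ)`, in terms of the
Fourier coefficients of `g` and `h` (arc length gives `Γ` the mass `2π`). -/
def circlePairing (a b : ℤ → ℂ) : ℂ := 2 * Real.pi * ∑' n, a n * conj (b n)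

/-- `g ∈ l^{2,p}(ℕ; H^{1/2}(Γ))`. -/
def MemSeqHalf (p : ℝ) (g : ℕ → L2Circle) : Prop :=
  (∀ j, Summable fun n : ℤ => (1 + (n : ℝ) ^ 2) ^ (1 / 2 : ℝ) * ‖coeff (g j) n‖ ^ 2) ∧
    Summable fun j : ℕ => (1 + (j : ℝ) ^ 2) ^ p *
      ∑' n : ℤ, (1 + (n : ℝ) ^ 2) ^ (1 / 2 : ℝ) * ‖coeff (g j) n‖ ^ 2

/-- The pairing `∫_Γ ⟨a, b⟩ ds` of sequences of distributions on `Γ`. -/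
def seqPairing (a b : ℕ → ℤ → ℂ) : ℂ := ∑' k, circlePairing (a k) (b k)

/-- `∫_Γ ∑_j ⟨L^{2j} g, ∂_s L^{2j} g⟩ ds`. -/
def boundaryTerm (g : ℕ → L2Circle) : ℂ :=
  ∑' j : ℕ, seqPairing (leftShift^[2 * j] fun k => coeff (g k))
    (leftShift^[2 * j] fun k => tangentialDeriv (coeff (g k)))

/-- Absolute convergence of the series that defines `boundaryTerm`. -/
def BoundaryConverges (g : ℕ → L2Circle) : Prop :=
  Summable fun q : ℕ × ℕ × ℤ =>
    (leftShift^[2 * q.1] fun k => coeff (g k)) q.2.1 q.2.2 *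
      conj ((leftShift^[2 * q.1] fun k => tangentialDeriv (coeff (g k))) q.2.1 q.2.2)

/-! ### The five series under the integral over `Ω` -/

/-- `Re ⟨L^{2j} ∂v, L^{2j-2} w⟩`, with `j + 1` in the place of `j`, so that `j` runs from `0`. -/
def crossTerm (v w : ℕ → L2Disc) (j : ℕ) (z : ℂ) : ℝ :=
  (l2Inner (evalAt (leftShift^[2 * (j + 1)] (dzSeq v)) z) (evalAt (leftShift^[2 * j] w) z)).re

/-- `Re ⟨L^{2j} w, L^{2j} f⟩`. -/
def innerTerm (w f : ℕ → L2Disc) (j : ℕ) (z : ℂ) : ℝ :=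
  (l2Inner (evalAt (leftShift^[2 * j] w) z) (evalAt (leftShift^[2 * j] f) z)).re

/-- `‖L^{2j} w‖²`. -/
def squareTerm (w : ℕ → L2Disc) (j : ℕ) (z : ℂ) : ℝ :=
  l2NormSq (evalAt (leftShift^[2 * j] w) z)

end BukhgeimBeltrami

end

open BukhgeimBeltrami

/-! The identity is Green's identity on the disc, applied to each entry, followed by a telescoping
sum. For `u` in `H¹(Ω)` with trace `g`, `‖∂u‖² - ‖∂̄u‖² = π ∑ n |gₙ|² = (i/2) ∫_Γ g \bar{∂_s g} ds`
(`exists_trace`, `circlePairing_tangentialDeriv`). Take `u = v_{k+2j}` and sum over all pairs `(j,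
k)`: the right side becomes the boundary term. On the left insert `∂̄v_m = (Bv)_m + f_m - ∂v_{m+2}`
and expand the square. The terms `‖∂v_{m+2}‖²` cancel all of `∑ ‖∂v_{k+2j}‖²` except the row `j =
0`, which is `∫ ‖∂v‖²` (`tsum_doubleIndex_sub`); the other terms are the five series over `Ω`. Each
index `m` is hit by at most `m + 1` pairs, so the weight `1/2` makes every double series absolutely
convergent (`summable_doubleIndex`).

For smooth `φ`, Green's identity comes from Fourier modes on circles. Let `a`, `A`, `B` be the modes
`n`, `n - 1`, `n + 1` of `φ`, `∂φ`, `∂̄φ` at radius `r`. Then `a' = A + B` and `n a = r (A - B)`,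
hence `(n |a|²)' = 2r (|A|² - |B|²)`; integrate over `[0, 1]` and use Parseval. The same equations
bound `∑ (1 + |n|) |a(1)|²` by the squared `H¹` norm up to a constant.

Functions in `H¹(Ω)` are limits of mollified dilations (`exists_smooth_approximation`). By that
bound the boundary values of the approximations are Cauchy in `H^{1/2}(Γ)`, so the trace and Green's
identity pass to the limit. -/

noncomputable section

namespace BukhgeimBeltrami

/-! ### Fourier modes on circles -/

/-- The `n`-th Fourier coefficient of `β ↦ w (r e^{iβ})`. -/
def mode (w : ℂ → ℂ) (n : ℤ) (r : ℝ) : ℂ :=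
  (1 / (2 * Real.pi) : ℂ) * ∫ β in (-Real.pi)..Real.pi, cexp (-(n * β * I)) * w (r * cexp (β * I))

/-- The pointwise operator `∂` on differentiable functions. -/
def dzFun (φ : ℂ → ℂ) (z : ℂ) : ℂ := (1 / 2 : ℂ) * (fderiv ℝ φ z 1 - I * fderiv ℝ φ z I)

/-- The pointwise operator `∂̄` on differentiable functions. -/
def dzbarFun (φ : ℂ → ℂ) (z : ℂ) : ℂ := (1 / 2 : ℂ) * (fderiv ℝ φ z 1 + I * fderiv ℝ φ z I)

lemma mode_continuous {w : ℂ → ℂ} (hw : Continuous w) (n : ℤ) : Continuous (mode w n) := by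
  unfold mode
  refine continuous_const.mul ?_
  apply intervalIntegral.continuous_parametric_intervalIntegral_of_continuous'
  simp only [Function.uncurry_def]
  fun_prop

lemma mode_eq_fourierCoeff (w : ℂ → ℂ) (n : ℤ) (r : ℝ) :
    mode w n r = fourierCoeff
      (fun β : AddCircle (2 * Real.pi) => w (r * (AddCircle.toCircle β : ℂ))) n := by
  have hpi : (Real.pi : ℂ) ≠ 0 := by exact_mod_cast Real.pi_ne_zero
  rw [fourierCoeff_eq_intervalIntegral _ n (-Real.pi), mode]
  have h1 : -Real.pi + 2 * Real.pi = Real.pi := by ring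
  rw [h1, Complex.real_smul]
  congr 1
  · push_cast; rfl
  · congr 1
    ext x
    rw [smul_eq_mul, fourier_coe_apply, AddCircle.toCircle_apply_mk]
    congr 2
    · push_cast; field_simp
    · rw [Circle.coe_exp]
      congr 2
      push_cast; field_simp

lemma hasSum_fourierCoeff_of_continuous {h : AddCircle (2 * Real.pi) → ℂ} (hh : Continuous h) :
    HasSum (fun n => ‖fourierCoeff h n‖ ^ 2) (∫ t, ‖h t‖ ^ 2 ∂AddCircle.haarAddCircle) := by
  have hm : MemLp h 2 AddCircle.haarAddCircle :=
    MemLp.of_bound hh.aestronglyMeasurable _ (ae_of_all _ fun x =>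
      ContinuousMap.norm_coe_le_norm ⟨h, hh⟩ x)
  convert hasSum_sq_fourierCoeff hm.toLp using 1
  · ext n
    rw [fourierCoeff_congr_ae hm.coeFn_toLp]
  · apply integral_congr_ae
    filter_upwards [hm.coeFn_toLp] with x hx
    rw [hx]

lemma hasSum_norm_sq_mode {w : ℂ → ℂ} (hw : Continuous w) (r : ℝ) :
    HasSum (fun n => ‖mode w n r‖ ^ 2)
      ((1 / (2 * Real.pi)) * ∫ β in (-Real.pi)..Real.pi, ‖w (r * cexp (β * I))‖ ^ 2) := by
  have hc : Continuous fun β : AddCircle (2 * Real.pi) => w (r * (AddCircle.toCircle β : ℂ)) := by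
    have := AddCircle.continuous_toCircle (T := 2 * Real.pi)
    fun_prop
  convert hasSum_fourierCoeff_of_continuous hc using 1
  · simp_rw [mode_eq_fourierCoeff]
  · rw [AddCircle.integral_haarAddCircle, ← AddCircle.intervalIntegral_preimage _ (-Real.pi)]
    have h1 : -Real.pi + 2 * Real.pi = Real.pi := by ring
    rw [h1, smul_eq_mul, one_div]
    congr 2
    ext x
    rw [AddCircle.toCircle_apply_mk, Circle.coe_exp]
    congr 4
    push_cast
    have hpi : (Real.pi : ℂ) ≠ 0 := by exact_mod_cast Real.pi_ne_zero
    field_simp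

lemma setIntegral_disc_eq_polar {w : ℂ → ℝ} (hw : Continuous w) :
    ∫ z in disc, w z =
      ∫ r in (0 : ℝ)..1, r * ∫ β in (-Real.pi)..Real.pi, w (r * cexp (β * I)) := by
  have hF : Continuous fun p : ℝ × ℝ => p.1 * w (p.1 * cexp (p.2 * I)) := by fun_prop
  rw [← integral_indicator measurableSet_ball, ← Complex.integral_comp_polarCoord_symm]
  have hset : polarCoord.target ∩ (Set.Ioo (0 : ℝ) 1 ×ˢ Set.Ioo (-Real.pi) Real.pi)
      = Set.Ioo (0 : ℝ) 1 ×ˢ Set.Ioo (-Real.pi) Real.pi := by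
    rw [polarCoord_target]
    ext p
    simp only [Set.mem_inter_iff, Set.mem_prod, Set.mem_Ioi, Set.mem_Ioo]
    tauto
  have e1 : ∫ p in polarCoord.target, p.1 • disc.indicator w (Complex.polarCoord.symm p)
      = ∫ p in polarCoord.target, (Set.Ioo (0 : ℝ) 1 ×ˢ Set.Ioo (-Real.pi) Real.pi).indicator
        (fun p : ℝ × ℝ => p.1 * w (p.1 * cexp (p.2 * I))) p := by
    apply setIntegral_congr_fun polarCoord.open_target.measurableSet
    intro p hp
    have hp' : 0 < p.1 ∧ -Real.pi < p.2 ∧ p.2 < Real.pi := by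
      rw [polarCoord_target] at hp
      simpa using hp
    have hs : Complex.polarCoord.symm p = p.1 * cexp (p.2 * I) := by
      rw [Complex.polarCoord_symm_apply, Complex.exp_mul_I, Complex.ofReal_cos, Complex.ofReal_sin]
    have hn : ‖(p.1 : ℂ) * cexp (p.2 * I)‖ = p.1 := by
      rw [norm_mul, Complex.norm_exp_ofReal_mul_I, mul_one, Complex.norm_real, Real.norm_eq_abs,
        abs_of_pos hp'.1]
    have hm : (p.1 : ℂ) * cexp (p.2 * I) ∈ disc ↔ p.1 < 1 := by rw [mem_ball_zero_iff, hn]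
    by_cases h1 : p.1 < 1
    · simp [hs, hm, hp', h1]
    · simp [hs, hm, h1]
  rw [e1, setIntegral_indicator (measurableSet_Ioo.prod measurableSet_Ioo), hset,
    Measure.volume_eq_prod, setIntegral_prod]
  · rw [intervalIntegral.integral_of_le zero_le_one, integral_Ioc_eq_integral_Ioo]
    congr 1
    ext r
    rw [intervalIntegral.integral_of_le (by linarith [Real.pi_pos]), integral_Ioc_eq_integral_Ioo,
      ← integral_const_mul]
  · refine IntegrableOn.mono_set (t := Set.Icc (0 : ℝ) 1 ×ˢ Set.Icc (-Real.pi) Real.pi) ?_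
      (Set.prod_mono Set.Ioo_subset_Icc_self Set.Ioo_subset_Icc_self)
    rw [← Measure.volume_eq_prod]
    exact hF.continuousOn.integrableOn_compact (isCompact_Icc.prod isCompact_Icc)

/-- Parseval's identity on the disc. -/
lemma hasSum_integral_mode {w : ℂ → ℂ} (hw : Continuous w) :
    HasSum (fun n => ∫ r in (0 : ℝ)..1, r * ‖mode w n r‖ ^ 2)
      ((1 / (2 * Real.pi)) * ∫ z in disc, ‖w z‖ ^ 2) := by
  have hc : Continuous fun z => ‖w z‖ ^ 2 := by fun_prop
  rw [setIntegral_disc_eq_polar hc, ← intervalIntegral.integral_const_mul]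
  have hs : ∀ r : ℝ, HasSum (fun n => r * ‖mode w n r‖ ^ 2) (1 / (2 * Real.pi) *
      (r * ∫ β in (-Real.pi)..Real.pi, ‖w (r * cexp (β * I))‖ ^ 2)) := by
    intro r
    have h := (hasSum_norm_sq_mode hw r).mul_left r
    rwa [mul_left_comm] at h
  -- The terms are nonnegative on `[0, 1]`, so each is its own majorant; the majorants sum to a
  -- function continuous in `r`.
  refine intervalIntegral.hasSum_integral_of_dominated_convergence
    (fun n r => r * ‖mode w n r‖ ^ 2) ?_ ?_ ?_ ?_ ?_
  · intro n
    have := mode_continuous hw n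
    exact (by fun_prop : Continuous fun r : ℝ => r * ‖mode w n r‖ ^ 2).aestronglyMeasurable
  · intro n
    refine ae_of_all _ fun t ht => ?_
    rw [Set.uIoc_of_le zero_le_one] at ht
    rw [Real.norm_of_nonneg]
    have := ht.1.le
    positivity
  · exact ae_of_all _ fun t _ => (hs t).summable
  · simp_rw [fun r => (hs r).tsum_eq]
    apply Continuous.intervalIntegrable
    refine continuous_const.mul (continuous_id.mul ?_)
    apply intervalIntegral.continuous_parametric_intervalIntegral_of_continuous'
    simp only [Function.uncurry_def]
    fun_prop
  · exact ae_of_all _ fun t _ => hs t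

/-! ### Radial and angular derivatives of the modes -/

lemma hasDerivAt_intervalIntegral_of_continuous {F F' : ℝ → ℝ → ℂ} (a b : ℝ)
    (hF : ∀ x, Continuous (F x)) (hF' : Continuous (Function.uncurry F'))
    (h : ∀ x t, HasDerivAt (fun x => F x t) (F' x t) x) (x₀ : ℝ) :
    HasDerivAt (fun x => ∫ t in a..b, F x t) (∫ t in a..b, F' x₀ t) x₀ := by
  obtain ⟨C, hC⟩ := ((isCompact_closedBall x₀ 1).prod (isCompact_uIcc (a := a) (b := b)))
    |>.exists_bound_of_continuousOn
    hF'.continuousOn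
  refine (intervalIntegral.hasDerivAt_integral_of_dominated_loc_of_deriv_le
    (bound := fun _ => C) (Metric.closedBall_mem_nhds x₀ one_pos)
    (Eventually.of_forall fun x => (hF x).aestronglyMeasurable)
    ((hF x₀).intervalIntegrable _ _) ?_ ?_ (by simp) ?_).2
  · exact (hF'.comp (by fun_prop : Continuous fun t : ℝ => (x₀, t))).aestronglyMeasurable
  · exact ae_of_all _ fun t ht x hx => hC (x, t) ⟨hx, Set.uIoc_subset_uIcc ht⟩
  · exact ae_of_all _ fun t _ x _ => h x t

/-- The Wirtinger form `dφ = ∂φ dz + ∂̄φ d\bar z`. It is used with `ζ = e^{iβ}` for radial and `ζ =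
i r e^{iβ}` for angular derivatives. -/
lemma fderiv_apply_eq_dzFun_dzbarFun (φ : ℂ → ℂ) (z ζ : ℂ) :
    fderiv ℝ φ z ζ = ζ * dzFun φ z + conj ζ * dzbarFun φ z := by
  have h : ζ = ζ.re • (1 : ℂ) + ζ.im • I := by simp [Complex.real_smul, Complex.re_add_im]
  have h1 : fderiv ℝ φ z ζ = ζ.re * fderiv ℝ φ z 1 + ζ.im * fderiv ℝ φ z I := by
    conv_lhs => rw [h]
    rw [map_add, map_smul, map_smul, Complex.real_smul, Complex.real_smul]
  have h2 : ζ = ζ.re + ζ.im * I := (Complex.re_add_im ζ).symm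
  have h3 : conj ζ = ζ.re - ζ.im * I := by
    apply Complex.ext <;> simp
  rw [h1, h3, dzFun, dzbarFun]
  conv_rhs => enter [1, 1]; rw [h2]
  linear_combination ((ζ.im : ℂ) * fderiv ℝ φ z I) * Complex.I_sq

lemma dzFun_continuous {φ : ℂ → ℂ} (hφ : ContDiff ℝ 1 φ) : Continuous (dzFun φ) := by
  have := hφ.continuous_fderiv one_ne_zero
  unfold dzFun
  fun_prop

lemma dzbarFun_continuous {φ : ℂ → ℂ} (hφ : ContDiff ℝ 1 φ) : Continuous (dzbarFun φ) := by
  have := hφ.continuous_fderiv one_ne_zero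
  unfold dzbarFun
  fun_prop

/-- The factor `e^{iβ}` that accompanies `∂φ` lowers the mode index by one; its conjugate, which
accompanies `∂̄φ`, raises it. -/
lemma exp_sub_one_mul (n : ℤ) (β : ℝ) :
    cexp (-(((n - 1 : ℤ) : ℂ) * β * I)) = cexp (-(n * β * I)) * cexp (β * I) := by
  rw [← Complex.exp_add]; congr 1; push_cast; ring

lemma exp_add_one_mul (n : ℤ) (β : ℝ) :
    cexp (-(((n + 1 : ℤ) : ℂ) * β * I)) = cexp (-(n * β * I)) * conj (cexp (β * I)) := by
  rw [← Complex.exp_conj, ← Complex.exp_add]; congr 1; simp; ring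

lemma mode_hasDerivAt {φ : ℂ → ℂ} (hφ : ContDiff ℝ 1 φ) (n : ℤ) (r : ℝ) :
    HasDerivAt (mode φ n) (mode (dzFun φ) (n - 1) r + mode (dzbarFun φ) (n + 1) r) r := by
  have c1 := dzFun_continuous hφ
  have c2 := dzbarFun_continuous hφ
  have c0 := hφ.continuous
  have hd : HasDerivAt (fun x : ℝ => ∫ β in (-Real.pi)..Real.pi,
      cexp (-(n * β * I)) * φ (x * cexp (β * I)))
      (∫ β in (-Real.pi)..Real.pi, (cexp (-(((n - 1 : ℤ) : ℂ) * β * I)) * dzFun φ (r * cexp (β * I))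
        + cexp (-(((n + 1 : ℤ) : ℂ) * β * I)) * dzbarFun φ (r * cexp (β * I)))) r := by
    refine hasDerivAt_intervalIntegral_of_continuous
      (F' := fun r β => cexp (-(((n - 1 : ℤ) : ℂ) * β * I)) * dzFun φ (r * cexp (β * I))
        + cexp (-(((n + 1 : ℤ) : ℂ) * β * I)) * dzbarFun φ (r * cexp (β * I))) _ _ ?_ ?_ ?_ r
    · intro x; fun_prop
    · simp only [Function.uncurry_def]; fun_prop
    · intro x t
      have h1 : HasDerivAt (fun x : ℝ => (x : ℂ) * cexp (t * I)) (cexp (t * I)) x := by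
        simpa using (Complex.ofRealCLM.hasDerivAt (x := x)).mul_const (cexp (t * I))
      have h2 := ((hφ.differentiable one_ne_zero (x * cexp (t * I))).hasFDerivAt.comp_hasDerivAt x
        h1).const_mul (cexp (-(n * t * I)))
      refine h2.congr_deriv ?_
      rw [fderiv_apply_eq_dzFun_dzbarFun, exp_sub_one_mul, exp_add_one_mul]
      ring
  have := hd.const_mul (1 / (2 * Real.pi) : ℂ)
  refine this.congr_deriv ?_
  rw [mode, mode, intervalIntegral.integral_add, mul_add]
  · exact (by fun_prop : Continuous _).intervalIntegrable _ _
  · exact (by fun_prop : Continuous _).intervalIntegrable _ _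

/-- The `β`-derivative of `e^{-inβ} φ(r e^{iβ})` integrates to zero over a period. -/
lemma int_mul_mode {φ : ℂ → ℂ} (hφ : ContDiff ℝ 1 φ) (n : ℤ) (r : ℝ) :
    n * mode φ n r = r * (mode (dzFun φ) (n - 1) r - mode (dzbarFun φ) (n + 1) r) := by
  have c1 := dzFun_continuous hφ
  have c2 := dzbarFun_continuous hφ
  have c0 := hφ.continuous
  have hd : ∀ t : ℝ, HasDerivAt (fun t : ℝ => cexp (-(n * t * I)) * φ (r * cexp (t * I)))
      (-(n * I) * (cexp (-(n * t * I)) * φ (r * cexp (t * I))) +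
        I * r * (cexp (-(((n - 1 : ℤ) : ℂ) * t * I)) * dzFun φ (r * cexp (t * I))
        - cexp (-(((n + 1 : ℤ) : ℂ) * t * I)) * dzbarFun φ (r * cexp (t * I)))) t := by
    intro t
    have h0 : HasDerivAt (fun t : ℝ => (t : ℂ)) 1 t := Complex.ofRealCLM.hasDerivAt
    have h1 : HasDerivAt (fun t : ℝ => (r : ℂ) * cexp (t * I)) (r * (cexp (t * I) * (1 * I))) t :=
      ((h0.mul_const I).cexp).const_mul _
    have h2 := ((hφ.differentiable one_ne_zero (r * cexp (t * I))).hasFDerivAt.comp_hasDerivAt t h1)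
    have h3 : HasDerivAt (fun t : ℝ => cexp (-(n * t * I)))
        (cexp (-(n * t * I)) * -(n * 1 * I)) t :=
      (((h0.const_mul (n : ℂ)).mul_const I).neg).cexp
    refine (h3.mul h2).congr_deriv ?_
    rw [fderiv_apply_eq_dzFun_dzbarFun, exp_sub_one_mul, exp_add_one_mul]
    simp only [map_mul, Complex.conj_ofReal, Complex.conj_I, map_one, Function.comp_apply]
    ring
  have hint := intervalIntegral.integral_eq_sub_of_hasDerivAt (a := -Real.pi) (b := Real.pi)
    (fun t _ => hd t) ((by fun_prop : Continuous _).intervalIntegrable _ _)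
  have hper : cexp (-(n * (Real.pi : ℝ) * I)) * φ (r * cexp ((Real.pi : ℝ) * I))
      = cexp (-(n * ((-Real.pi : ℝ) : ℂ) * I)) * φ (r * cexp (((-Real.pi : ℝ) : ℂ) * I)) := by
    have e1 : cexp (((-Real.pi : ℝ) : ℂ) * I) = cexp ((Real.pi : ℝ) * I) := by
      rw [show (((-Real.pi : ℝ) : ℂ) * I) =
          (Real.pi : ℝ) * I + ((-1 : ℤ) : ℂ) * (2 * Real.pi * I) by
        push_cast; ring, Complex.exp_add, Complex.exp_int_mul_two_pi_mul_I, mul_one]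
    have e2 : cexp (-(n * ((-Real.pi : ℝ) : ℂ) * I)) = cexp (-(n * (Real.pi : ℝ) * I)) := by
      rw [show (-(n * ((-Real.pi : ℝ) : ℂ) * I)) =
          -(n * (Real.pi : ℝ) * I) + (n : ℂ) * (2 * Real.pi * I) by
        push_cast; ring, Complex.exp_add, Complex.exp_int_mul_two_pi_mul_I, mul_one]
    rw [e1, e2]
  rw [hper, sub_self, intervalIntegral.integral_add, intervalIntegral.integral_const_mul,
    intervalIntegral.integral_const_mul, intervalIntegral.integral_sub] at hint
  · simp only [mode]
    linear_combination (1 / (2 * Real.pi) : ℂ) * I * hint + (1 / (2 * Real.pi) : ℂ) *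
      (n * (∫ β in (-Real.pi)..Real.pi, cexp (-(n * β * I)) * φ (r * cexp (β * I))) -
       r * (∫ β in (-Real.pi)..Real.pi,
         cexp (-(((n - 1 : ℤ) : ℂ) * β * I)) * dzFun φ (r * cexp (β * I)))
       + r * (∫ β in (-Real.pi)..Real.pi,
         cexp (-(((n + 1 : ℤ) : ℂ) * β * I)) * dzbarFun φ (r * cexp (β * I)))) * Complex.I_sq
  all_goals exact (by fun_prop : Continuous _).intervalIntegrable _ _

/-- Green's identity for one mode: `(n |a|²)' = 2 Re (n a \bar{a'}) = 2r Re ((A - B) \overline{(A +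
B)}) = 2r (|A|² - |B|²)`. -/
lemma int_mul_norm_sq_mode_one {φ : ℂ → ℂ} (hφ : ContDiff ℝ 1 φ) (n : ℤ) :
    n * ‖mode φ n 1‖ ^ 2 = 2 * ((∫ r in (0 : ℝ)..1, r * ‖mode (dzFun φ) (n - 1) r‖ ^ 2)
      - ∫ r in (0 : ℝ)..1, r * ‖mode (dzbarFun φ) (n + 1) r‖ ^ 2) := by
  have c1 := mode_continuous (dzFun_continuous hφ) (n - 1)
  have c2 := mode_continuous (dzbarFun_continuous hφ) (n + 1)
  have hd : ∀ r : ℝ, HasDerivAt (fun r => (n : ℝ) * ‖mode φ n r‖ ^ 2)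
      (2 * (r * ‖mode (dzFun φ) (n - 1) r‖ ^ 2 - r * ‖mode (dzbarFun φ) (n + 1) r‖ ^ 2)) r := by
    intro r
    refine ((mode_hasDerivAt hφ n r).norm_sq.const_mul (n : ℝ)).congr_deriv ?_
    have h := int_mul_mode hφ n r
    set A := mode (dzFun φ) (n - 1) r
    set B := mode (dzbarFun φ) (n + 1) r
    have hre := congrArg Complex.re h
    have him := congrArg Complex.im h
    simp only [Complex.mul_re, Complex.mul_im, Complex.intCast_re, Complex.intCast_im,
      Complex.ofReal_re, Complex.ofReal_im, Complex.sub_re, Complex.sub_im, zero_mul, sub_zero,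
      add_zero] at hre him
    rw [← Complex.normSq_eq_norm_sq, ← Complex.normSq_eq_norm_sq, Complex.normSq_apply,
      Complex.normSq_apply, Complex.inner]
    simp only [Complex.mul_re, Complex.conj_re, Complex.conj_im, Complex.add_re, Complex.add_im]
    linear_combination (2 * (A.re + B.re)) * hre + (2 * (A.im + B.im)) * him
  have hint := intervalIntegral.integral_eq_sub_of_hasDerivAt (a := 0) (b := 1)
    (fun t _ => hd t) ((by fun_prop : Continuous _).intervalIntegrable _ _)
  -- No contribution from the centre: the factor `r` in `int_mul_mode` vanishes there.
  have h0 : (n : ℝ) * ‖mode φ n 0‖ ^ 2 = 0 := by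
    have h := int_mul_mode hφ n 0
    rw [Complex.ofReal_zero, zero_mul, mul_eq_zero] at h
    rcases h with h | h
    · have : (n : ℝ) = 0 := by exact_mod_cast h
      rw [this, zero_mul]
    · rw [h]; simp
  rw [h0, sub_zero, intervalIntegral.integral_const_mul, intervalIntegral.integral_sub] at hint
  · exact hint.symm
  all_goals exact (by fun_prop : Continuous _).intervalIntegrable _ _

/-- The weight `r²` removes the endpoint `r = 0` when `(r² |a|²)'` is integrated. Young's inequality
and `r² ≤ r` bound the derivative; the constant `3` is `2` from `(r²)'` plus `1` from Young. -/
lemma norm_sq_mode_one_le {φ : ℂ → ℂ} (hφ : ContDiff ℝ 1 φ) (n : ℤ) :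
    ‖mode φ n 1‖ ^ 2 ≤ 3 * (∫ r in (0 : ℝ)..1, r * ‖mode φ n r‖ ^ 2)
      + 2 * (∫ r in (0 : ℝ)..1, r * ‖mode (dzFun φ) (n - 1) r‖ ^ 2)
      + 2 * ∫ r in (0 : ℝ)..1, r * ‖mode (dzbarFun φ) (n + 1) r‖ ^ 2 := by
  have c0 := mode_continuous hφ.continuous n
  have c1 := mode_continuous (dzFun_continuous hφ) (n - 1)
  have c2 := mode_continuous (dzbarFun_continuous hφ) (n + 1)
  have hd : ∀ r : ℝ, HasDerivAt (fun r => r ^ 2 * ‖mode φ n r‖ ^ 2)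
      (2 * r * ‖mode φ n r‖ ^ 2 + r ^ 2 * (2 * inner ℝ (mode φ n r)
        (mode (dzFun φ) (n - 1) r + mode (dzbarFun φ) (n + 1) r))) r := by
    intro r
    refine ((hasDerivAt_pow 2 r).mul (mode_hasDerivAt hφ n r).norm_sq).congr_deriv ?_
    simp
  have hint := intervalIntegral.integral_eq_sub_of_hasDerivAt (a := 0) (b := 1)
    (fun t _ => hd t) ((by fun_prop : Continuous _).intervalIntegrable _ _)
  have e : ‖mode φ n 1‖ ^ 2 = ∫ r in (0 : ℝ)..1, (2 * r * ‖mode φ n r‖ ^ 2 + r ^ 2 *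
      (2 * inner ℝ (mode φ n r) (mode (dzFun φ) (n - 1) r + mode (dzbarFun φ) (n + 1) r))) := by
    rw [hint]; simp
  rw [e, ← intervalIntegral.integral_const_mul, ← intervalIntegral.integral_const_mul,
    ← intervalIntegral.integral_const_mul, ← intervalIntegral.integral_add,
    ← intervalIntegral.integral_add]
  · apply intervalIntegral.integral_mono_on zero_le_one
    · exact (by fun_prop : Continuous _).intervalIntegrable _ _
    · exact (by fun_prop : Continuous _).intervalIntegrable _ _
    · intro r hr
      set a := mode φ n r
      set A := mode (dzFun φ) (n - 1) r
      set B := mode (dzbarFun φ) (n + 1) r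
      have h1 : 2 * inner ℝ a (A + B) ≤ ‖a‖ ^ 2 + ‖A + B‖ ^ 2 := by
        nlinarith [real_inner_le_norm a (A + B), sq_nonneg (‖a‖ - ‖A + B‖)]
      have h2 : ‖A + B‖ ^ 2 ≤ 2 * ‖A‖ ^ 2 + 2 * ‖B‖ ^ 2 := by
        nlinarith [norm_add_le A B, norm_nonneg (A + B), sq_nonneg (‖A‖ - ‖B‖)]
      have h3 : r ^ 2 * (2 * inner ℝ a (A + B)) ≤
          r ^ 2 * (‖a‖ ^ 2 + 2 * ‖A‖ ^ 2 + 2 * ‖B‖ ^ 2) :=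
        mul_le_mul_of_nonneg_left (by linarith) (sq_nonneg r)
      have h4 : r ^ 2 * (‖a‖ ^ 2 + 2 * ‖A‖ ^ 2 + 2 * ‖B‖ ^ 2) ≤
          r * (‖a‖ ^ 2 + 2 * ‖A‖ ^ 2 + 2 * ‖B‖ ^ 2) :=
        mul_le_mul_of_nonneg_right (by nlinarith [hr.1, hr.2]) (by positivity)
      linarith
  all_goals exact (by fun_prop : Continuous _).intervalIntegrable _ _

/-! ### Approximation of `H¹` functions on the disc by smooth functions -/

open ContinuousLinearMap (lsmul)
open scoped Convolution

lemma eLpNorm_two_sq {X E : Type*} [MeasurableSpace X] [NormedAddCommGroup E] (μ : Measure X)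
    (F : X → E) : eLpNorm F 2 μ ^ 2 = ∫⁻ x, ‖F x‖ₑ ^ 2 ∂μ := by
  have h := eLpNorm_nnreal_pow_eq_lintegral (f := F) (μ := μ) (p := 2) two_ne_zero
  simpa using h

/-- The bump is a probability density, so the convolution averages translates of `U`: the `L¹` norm
is at most the `L²` norm on a probability space, and Tonelli with translation invariance finishes.
-/
lemma eLpNorm_convolution_le (ρ : ContDiffBump (0 : ℂ)) {U : ℂ → ℂ} (hU : StronglyMeasurable U) :
    eLpNorm (ρ.normed volume ⋆[lsmul ℝ ℝ, volume] U) 2 volume ≤ eLpNorm U 2 volume := by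
  set d : ℂ → ℝ≥0∞ := fun y => ENNReal.ofReal (ρ.normed volume y) with hd
  have hdm : Measurable d := (ρ.continuous_normed (μ := volume)).measurable.ennreal_ofReal
  set ν := (volume : Measure ℂ).withDensity d with hν
  have hprob : IsProbabilityMeasure ν := by
    constructor
    rw [hν, withDensity_apply _ MeasurableSet.univ, setLIntegral_univ,
      ← ofReal_integral_eq_lintegral_ofReal ρ.integrable_normed
        (ae_of_all _ fun x => ρ.nonneg_normed x), ρ.integral_normed, ENNReal.ofReal_one]
  have hconv : ∀ x, (ρ.normed volume ⋆[lsmul ℝ ℝ, volume] U) x = ∫ y, U (x - y) ∂ν := by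
    intro x
    rw [hν, integral_withDensity_eq_integral_toReal_smul hdm (ae_of_all _ fun _ => by simp [hd])]
    rw [convolution_def]
    refine integral_congr_ae (ae_of_all _ fun y => ?_)
    simp [hd, ENNReal.toReal_ofReal (ρ.nonneg_normed y)]
  have hpt : ∀ x, ‖(ρ.normed volume ⋆[lsmul ℝ ℝ, volume] U) x‖ₑ ^ 2
      ≤ ∫⁻ y, ‖U (x - y)‖ₑ ^ 2 ∂ν := by
    intro x
    rw [hconv, ← eLpNorm_two_sq]
    have h1 : ‖∫ y, U (x - y) ∂ν‖ₑ ≤ eLpNorm (fun y => U (x - y)) 1 ν := by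
      rw [eLpNorm_one_eq_lintegral_enorm]
      exact enorm_integral_le_lintegral_enorm _
    have h2 : eLpNorm (fun y => U (x - y)) 1 ν ≤ eLpNorm (fun y => U (x - y)) 2 ν :=
      eLpNorm_le_eLpNorm_of_exponent_le one_le_two
        (hU.comp_measurable (measurable_const.sub measurable_id)).aestronglyMeasurable
    gcongr
    exact h1.trans h2
  have key : eLpNorm (ρ.normed volume ⋆[lsmul ℝ ℝ, volume] U) 2 volume ^ 2
      ≤ eLpNorm U 2 volume ^ 2 := by
    rw [eLpNorm_two_sq, eLpNorm_two_sq]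
    calc ∫⁻ x, ‖(ρ.normed volume ⋆[lsmul ℝ ℝ, volume] U) x‖ₑ ^ 2
        ≤ ∫⁻ x, ∫⁻ y, ‖U (x - y)‖ₑ ^ 2 ∂ν := lintegral_mono hpt
      _ = ∫⁻ y, (∫⁻ x, ‖U (x - y)‖ₑ ^ 2) ∂ν := by
          apply lintegral_lintegral_swap
          exact ((hU.comp_measurable (measurable_fst.sub measurable_snd)).enorm.pow_const
            2).aemeasurable
      _ = ∫⁻ y, (∫⁻ x, ‖U x‖ₑ ^ 2) ∂ν := by
          congr 1; ext y
          exact lintegral_sub_right_eq_self (fun x => ‖U x‖ₑ ^ 2) y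
      _ = ∫⁻ x, ‖U x‖ₑ ^ 2 := by simp
  exact (ENNReal.pow_le_pow_left_iff two_ne_zero).1 key

/-- The dilation scales area by `r⁻² ≤ 4`, hence the norm by at most `2`. -/
lemma eLpNorm_comp_mul_le {r : ℝ} (hr : 1 / 2 ≤ r) {F : ℂ → ℂ}
    (hF : AEStronglyMeasurable F volume) :
    eLpNorm (fun z => F (r * z)) 2 volume ≤ 2 * eLpNorm F 2 volume := by
  have hr0 : r ≠ 0 := by linarith
  have hmap : Measure.map (fun z : ℂ => r * z) volume =
      ENNReal.ofReal |(r ^ 2)⁻¹| • (volume : Measure ℂ) := by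
    have := Measure.map_addHaar_smul (volume : Measure ℂ) hr0
    rw [Complex.finrank_real_complex] at this
    rw [← this]
    congr 1
  have hm : Measurable fun z : ℂ => r * z := by fun_prop
  have h1 : eLpNorm (fun z => F (r * z)) 2 volume ^ 2 ≤ (2 * eLpNorm F 2 volume) ^ 2 := by
    have h2 : eLpNorm (fun z => F (r * z)) 2 volume
        = eLpNorm F 2 (Measure.map (fun z : ℂ => r * z) volume) := by
      rw [eLpNorm_map_measure _ hm.aemeasurable]
      · rfl
      · rw [hmap]; exact hF.smul_measure _
    rw [h2, eLpNorm_two_sq, hmap, lintegral_smul_measure, mul_pow, eLpNorm_two_sq, smul_eq_mul]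
    gcongr
    rw [show (2 : ℝ≥0∞) ^ 2 = ENNReal.ofReal 4 by norm_num]
    apply ENNReal.ofReal_le_ofReal
    rw [abs_of_nonneg (by positivity)]
    rw [inv_le_comm₀ (by positivity) (by norm_num)]
    nlinarith
  exact (ENNReal.pow_le_pow_left_iff two_ne_zero).1 h1

lemma convolution_normed_contDiff (ρ : ContDiffBump (0 : ℂ)) {U : ℂ → ℂ}
    (hU : LocallyIntegrable U volume) :
    ContDiff ℝ ∞ (ρ.normed volume ⋆[lsmul ℝ ℝ, volume] U) :=
  ρ.hasCompactSupport_normed.contDiff_convolution_left _ ρ.contDiff_normed hU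

/-- Mollified dilations converge in `L²` of the disc. -/
lemma exists_forall_eLpNorm_mollify_sub_le {U : ℂ → ℂ} (hUm : StronglyMeasurable U)
    (hU : MemLp U 2 volume) {η : ℝ≥0∞} (hη : η ≠ 0) :
    ∃ δ > 0, ∀ (ρ : ContDiffBump (0 : ℂ)) (r : ℝ), ρ.rOut < δ → 1 - δ < r → 1 / 2 ≤ r → r ≤ 1 →
      eLpNorm (fun z => (ρ.normed volume ⋆[lsmul ℝ ℝ, volume] U) (r * z) - U z) 2 discMeasure
        ≤ η := by
  have hη4 : η / 4 ≠ 0 := by simp [hη]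
  -- Error budget: `U - h` costs `2 · η/4` after mollifying and dilating and `η/4` by itself; the
  -- uniformly continuous `h` costs the last `η/4`. Only the modulus of continuity of `h` determines
  -- `δ`.
  obtain ⟨h, hcs, hle, hc, hmem⟩ := hU.exists_hasCompactSupport_eLpNorm_sub_le (by simp) hη4
  have huc : UniformContinuous h := hcs.uniformContinuous_of_continuous hc
  -- a real number `c` bounding the uniform error
  obtain ⟨c, hc0, hcη⟩ : ∃ c : ℝ, 0 < c ∧
      discMeasure Set.univ ^ (2 : ℝ≥0∞).toReal⁻¹ * ENNReal.ofReal c ≤ η / 4 := by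
    set K := discMeasure Set.univ ^ (2 : ℝ≥0∞).toReal⁻¹ with hK
    have hKt : K ≠ ⊤ := by
      rw [hK]
      refine ENNReal.rpow_ne_top_of_nonneg (by positivity) ?_
      rw [Measure.restrict_apply_univ]
      exact measure_ball_lt_top.ne
    have ht : Tendsto (fun c : ℝ => K * ENNReal.ofReal c) (𝓝[>] 0) (𝓝 (K * ENNReal.ofReal 0)) :=
      (ENNReal.Tendsto.const_mul (ENNReal.continuous_ofReal.tendsto 0) (Or.inr hKt)).mono_left
        nhdsWithin_le_nhds
    rw [ENNReal.ofReal_zero, mul_zero] at ht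
    have h1 := ht.eventually (gt_mem_nhds (pos_iff_ne_zero.2 hη4))
    obtain ⟨c, hc1, hc2⟩ := (h1.and self_mem_nhdsWithin).exists
    exact ⟨c, hc2, hc1.le⟩
  obtain ⟨δ, hδ, hδc⟩ := Metric.uniformContinuous_iff.1 huc (c / 2) (half_pos hc0)
  refine ⟨δ, hδ, fun ρ r hρ hrδ hr2 hr1 => ?_⟩
  have hUl : LocallyIntegrable U volume := hU.locallyIntegrable one_le_two
  have hhl : LocallyIntegrable h volume := hmem.locallyIntegrable one_le_two
  have hdl : LocallyIntegrable (U - h) volume := hUl.sub hhl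
  have hdm : StronglyMeasurable (U - h) := hUm.sub hc.stronglyMeasurable
  have hsplit : ρ.normed volume ⋆[lsmul ℝ ℝ, volume] U =
      (ρ.normed volume ⋆[lsmul ℝ ℝ, volume] (U - h)) +
        (ρ.normed volume ⋆[lsmul ℝ ℝ, volume] h) := by
    rw [← ConvolutionExists.distrib_add]
    · simp
    · exact ρ.hasCompactSupport_normed.convolutionExists_left _ ρ.continuous_normed hdl
    · exact ρ.hasCompactSupport_normed.convolutionExists_left _ ρ.continuous_normed hhl
  have cd := (convolution_normed_contDiff ρ hdl).continuous
  have ch := (convolution_normed_contDiff ρ hhl).continuous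
  have e1 : (fun z => (ρ.normed volume ⋆[lsmul ℝ ℝ, volume] U) (r * z) - U z) =
      (fun z => (ρ.normed volume ⋆[lsmul ℝ ℝ, volume] (U - h)) (r * z)) +
      ((fun z => (ρ.normed volume ⋆[lsmul ℝ ℝ, volume] h) (r * z) - h z) + -(U - h)) := by
    ext z
    simp only [hsplit, Pi.add_apply, Pi.neg_apply, Pi.sub_apply]
    ring
  have b1 : eLpNorm (fun z => (ρ.normed volume ⋆[lsmul ℝ ℝ, volume] (U - h)) (r * z)) 2 discMeasure
      ≤ 2 * (η / 4) := by
    calc _ ≤ eLpNorm (fun z => (ρ.normed volume ⋆[lsmul ℝ ℝ, volume] (U - h)) (r * z)) 2 volume :=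
          eLpNorm_mono_measure _ Measure.restrict_le_self
      _ ≤ 2 * eLpNorm (ρ.normed volume ⋆[lsmul ℝ ℝ, volume] (U - h)) 2 volume :=
          eLpNorm_comp_mul_le hr2 cd.aestronglyMeasurable
      _ ≤ 2 * (η / 4) := by
          gcongr
          exact (eLpNorm_convolution_le ρ hdm).trans hle
  have b2 : eLpNorm (fun z => (ρ.normed volume ⋆[lsmul ℝ ℝ, volume] h) (r * z) - h z) 2 discMeasure
      ≤ η / 4 := by
    refine (eLpNorm_le_of_ae_bound (C := c) ?_).trans hcη
    filter_upwards [ae_restrict_mem measurableSet_ball] with z hz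
    rw [mem_ball_zero_iff] at hz
    have d1 : dist ((ρ.normed volume ⋆[lsmul ℝ ℝ, volume] h) (r * z)) (h (r * z)) ≤ c / 2 := by
      apply ContDiffBump.dist_normed_convolution_le hc.aestronglyMeasurable
      intro x hx
      exact (hδc (lt_trans hx hρ)).le
    have d2 : dist (h (r * z)) (h z) ≤ c / 2 := by
      refine (hδc ?_).le
      have : (r : ℂ) * z - z = ((r - 1 : ℝ) : ℂ) * z := by push_cast; ring
      rw [dist_eq_norm, this, norm_mul, Complex.norm_real, Real.norm_eq_abs,
        abs_of_nonpos (by linarith)]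
      nlinarith [norm_nonneg z]
    rw [← dist_eq_norm]
    linarith [dist_triangle ((ρ.normed volume ⋆[lsmul ℝ ℝ, volume] h) (r * z)) (h (r * z)) (h z)]
  have b3 : eLpNorm (-(U - h)) 2 discMeasure ≤ η / 4 := by
    rw [eLpNorm_neg]
    exact (eLpNorm_mono_measure _ Measure.restrict_le_self).trans hle
  rw [e1]
  refine (eLpNorm_add_le (by fun_prop : Continuous _).aestronglyMeasurable
    (((by fun_prop : Continuous _).aestronglyMeasurable).add hdm.neg.aestronglyMeasurable)
    one_le_two).trans ?_
  refine (add_le_add b1 ((eLpNorm_add_le (by fun_prop : Continuous _).aestronglyMeasurable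
    hdm.neg.aestronglyMeasurable one_le_two).trans (add_le_add b2 b3))).trans (le_of_eq ?_)
  have : 2 * (η / 4) + (η / 4 + η / 4) = (η / 4) * 4 := by ring
  rw [this, ENNReal.div_mul_cancel (by simp) (by simp)]

/-- The extension by zero of an element of `L²(Ω)`. -/
def extendZero (u : L2Disc) : ℂ → ℂ := disc.indicator u

lemma extendZero_stronglyMeasurable (u : L2Disc) : StronglyMeasurable (extendZero u) :=
  (Lp.stronglyMeasurable u).indicator measurableSet_ball

lemma extendZero_memLp (u : L2Disc) : MemLp (extendZero u) 2 volume :=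
  (memLp_indicator_iff_restrict measurableSet_ball).2 (Lp.memLp u)

lemma extendZero_locallyIntegrable (u : L2Disc) : LocallyIntegrable (extendZero u) volume :=
  (extendZero_memLp u).locallyIntegrable one_le_two

lemma eLpNorm_sub_extendZero (F : ℂ → ℂ) (u : L2Disc) :
    eLpNorm (fun z => F z - u z) 2 discMeasure =
      eLpNorm (fun z => F z - extendZero u z) 2 discMeasure := by
  apply eLpNorm_congr_ae
  filter_upwards [ae_restrict_mem measurableSet_ball] with z hz
  rw [extendZero, Set.indicator_of_mem hz]

lemma integral_mul_extendZero (u : L2Disc) (k : ℂ → ℂ) :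
    ∫ t, extendZero u t * k t = ∫ t in disc, u t * k t := by
  rw [← integral_indicator measurableSet_ball]
  congr 1
  ext t
  by_cases ht : t ∈ disc <;> simp [extendZero, ht]

lemma convolution_eq_integral (ρ : ContDiffBump (0 : ℂ)) (U : ℂ → ℂ) (x : ℂ) :
    (ρ.normed volume ⋆[lsmul ℝ ℝ, volume] U) x
      = ∫ t, U t * (ρ.normed volume (x - t) : ℂ) := by
  rw [← convolution_flip, convolution_def]
  congr 1
  ext t
  simp [mul_comm]

/-- Mollification commutes with weak derivatives away from the boundary. -/
lemma fderiv_convolution_of_hasWeakDeriv (ρ : ContDiffBump (0 : ℂ)) {e : ℂ} {u w : L2Disc}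
    (h : HasWeakDeriv e u w) {x : ℂ} (hx : ‖x‖ + ρ.rOut < 1) :
    fderiv ℝ (ρ.normed volume ⋆[lsmul ℝ ℝ, volume] extendZero u) x e =
      (ρ.normed volume ⋆[lsmul ℝ ℝ, volume] extendZero w) x := by
  have hρ1 : ContDiff ℝ 1 (ρ.normed (volume : Measure ℂ)) := ρ.contDiff_normed
  have hd := ρ.hasCompactSupport_normed.hasFDerivAt_convolution_right (lsmul ℝ ℝ).flip
    (extendZero_locallyIntegrable u) hρ1 x
  rw [convolution_flip] at hd
  rw [hd.fderiv, convolution_precompR_apply _ (extendZero_locallyIntegrable u)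
    (ρ.hasCompactSupport_normed.fderiv ℝ) (hρ1.continuous_fderiv one_ne_zero), convolution_def]
  have hψd : ∀ t, fderiv ℝ (fun t => (ρ.normed volume (x - t) : ℂ)) t e =
      -(fderiv ℝ (ρ.normed volume) (x - t) e : ℂ) := by
    intro t
    have h1 : HasFDerivAt (fun t : ℂ => x - t) (-ContinuousLinearMap.id ℝ ℂ) t :=
      (hasFDerivAt_id t).const_sub x
    have h2 := Complex.ofRealCLM.hasFDerivAt.comp t
      (((hρ1.differentiable one_ne_zero (x - t)).hasFDerivAt).comp t h1)
    have h3 : (Complex.ofRealCLM ∘ ρ.normed volume ∘ fun t => x - t) =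
      fun t => (ρ.normed volume (x - t) : ℂ) := rfl
    rw [h3] at h2
    rw [h2.fderiv]
    simp
  have hsupp : tsupport (fun t => (ρ.normed volume (x - t) : ℂ)) ⊆ Metric.closedBall x ρ.rOut := by
    refine closure_minimal ?_ Metric.isClosed_closedBall
    intro t ht
    have h1 : x - t ∈ Function.support (ρ.normed volume) := by
      intro h0
      apply ht
      simp [h0]
    rw [ρ.support_normed_eq, mem_ball_zero_iff] at h1
    rw [Metric.mem_closedBall, dist_comm, dist_eq_norm]
    exact h1.le
  -- The test function `t ↦ ρ(x - t)` is supported in the ball of radius `ρ.rOut` about `x`, inside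
  -- `Ω` by `hx`. Its inner minus sign cancels the one in the definition of the weak derivative.
  have hψ := h (fun t => (ρ.normed volume (x - t) : ℂ)) ?_ ?_ ?_
  · rw [convolution_eq_integral, integral_mul_extendZero]
    have h4 : ∀ t, (lsmul ℝ ℝ).flip (extendZero u t) (fderiv ℝ (ρ.normed volume) (x - t) e) =
        extendZero u t * (fderiv ℝ (ρ.normed volume) (x - t) e : ℂ) := by
      intro t; simp [mul_comm]
    simp_rw [h4]
    rw [integral_mul_extendZero]
    simp_rw [hψd, mul_neg, integral_neg] at hψ
    exact neg_injective hψ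
  · exact Complex.ofRealCLM.contDiff.comp (ρ.contDiff_normed.comp (contDiff_const.sub contDiff_id))
  · exact HasCompactSupport.of_support_subset_isCompact (isCompact_closedBall x ρ.rOut)
      ((subset_tsupport _).trans hsupp)
  · refine hsupp.trans fun t ht => ?_
    rw [mem_ball_zero_iff]
    rw [Metric.mem_closedBall, dist_eq_norm] at ht
    linarith [norm_sub_norm_le t x]

/-- Contracting by `1 - ε` leaves a gap `ε` to the circle, wider than the mollifier radius `ε/2`, so
mollification and weak derivative commute at every point used. No extension of `u` within `H¹` is
needed. -/
lemma exists_smooth_approximation (u : L2Disc) (hu : IsH1 u) :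
    ∃ φ : ℕ → ℂ → ℂ, (∀ n, ContDiff ℝ ∞ (φ n)) ∧
    Tendsto (fun n => eLpNorm (fun z => φ n z - u z) 2 discMeasure) atTop (𝓝 0) ∧
    (∀ e ∈ ({1, I} : Set ℂ),
      Tendsto (fun n => eLpNorm (fun z => fderiv ℝ (φ n) z e - weakDeriv e u z) 2 discMeasure)
        atTop (𝓝 0)) := by
  set ε : ℕ → ℝ := fun n => 1 / ((n : ℝ) + 2) with hε
  have hε0 : ∀ n, 0 < ε n := fun n => by simp only [hε]; positivity
  have hε1 : ∀ n, ε n ≤ 1 / 2 := fun n => by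
    simp only [hε]
    exact one_div_le_one_div_of_le two_pos (by linarith [(Nat.cast_nonneg n : (0 : ℝ) ≤ n)])
  have hεt : Tendsto ε atTop (𝓝 0) :=
    (tendsto_const_nhds (x := (1 : ℝ))).div_atTop
      (tendsto_atTop_add_const_right _ _ tendsto_natCast_atTop_atTop)
  let ρ : ℕ → ContDiffBump (0 : ℂ) := fun n =>
    ⟨ε n / 4, ε n / 2, by linarith [hε0 n], by linarith [hε0 n]⟩
  have hmol : ∀ w : L2Disc, Tendsto (fun n => eLpNorm (fun z =>
      ((ρ n).normed volume ⋆[lsmul ℝ ℝ, volume] extendZero w) ((1 - ε n : ℝ) * z) - w z)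
      2 discMeasure) atTop (𝓝 0) := by
    intro w
    rw [ENNReal.tendsto_nhds_zero]
    intro η hη
    obtain ⟨δ, hδ, hδη⟩ := exists_forall_eLpNorm_mollify_sub_le (extendZero_stronglyMeasurable w)
      (extendZero_memLp w) hη.ne'
    filter_upwards [hεt.eventually (gt_mem_nhds hδ)] with n hn
    rw [eLpNorm_sub_extendZero]
    exact hδη (ρ n) (1 - ε n) (by simp only [ρ]; linarith [hε0 n]) (by linarith)
      (by linarith [hε1 n]) (by linarith [hε0 n])
  refine ⟨fun n z => ((ρ n).normed volume ⋆[lsmul ℝ ℝ, volume] extendZero u) ((1 - ε n : ℝ) * z),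
    fun n => ?_, hmol u, fun e he => ?_⟩
  · exact (convolution_normed_contDiff (ρ n) (extendZero_locallyIntegrable u)).comp
      (contDiff_const.mul contDiff_id)
  · have hw : HasWeakDeriv e u (weakDeriv e u) := by
      have hex : ∃ w, HasWeakDeriv e u w := by
        rcases he with rfl | he
        · exact hu.1
        · rw [Set.mem_singleton_iff] at he
          exact he ▸ hu.2
      rw [weakDeriv, dif_pos hex]
      exact hex.choose_spec
    set w := weakDeriv e u
    -- The chain rule gives the factor `1 - ε`. With `M` the mollified dilation of `w`, `(1 - ε) M -
    -- w = (1 - ε)(M - w) - ε w`.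
    have hbd : ∀ n, eLpNorm (fun z => fderiv ℝ (fun z => ((ρ n).normed volume ⋆[lsmul ℝ ℝ, volume]
        extendZero u) ((1 - ε n : ℝ) * z)) z e - w z) 2 discMeasure ≤
        eLpNorm (fun z => ((ρ n).normed volume ⋆[lsmul ℝ ℝ, volume] extendZero w)
          ((1 - ε n : ℝ) * z) - w z) 2 discMeasure +
          ENNReal.ofReal (ε n) * eLpNorm w 2 discMeasure := by
      intro n
      have hc := (convolution_normed_contDiff (ρ n) (extendZero_locallyIntegrable w)).continuous
      have e1 : (fun z => fderiv ℝ (fun z => ((ρ n).normed volume ⋆[lsmul ℝ ℝ, volume]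
          extendZero u) ((1 - ε n : ℝ) * z)) z e - w z) =ᵐ[discMeasure]
          ((1 - ε n : ℝ) • fun z => ((ρ n).normed volume ⋆[lsmul ℝ ℝ, volume] extendZero w)
          ((1 - ε n : ℝ) * z) - w z) + ((-ε n) • fun z => w z) := by
        filter_upwards [ae_restrict_mem measurableSet_ball] with z hz
        rw [mem_ball_zero_iff] at hz
        have hd : HasFDerivAt (fun z : ℂ => ((1 - ε n : ℝ) : ℂ) * z)
            ((1 - ε n : ℝ) • ContinuousLinearMap.id ℝ ℂ) z := by
          exact ((hasFDerivAt_id (𝕜 := ℝ) z).const_smul (1 - ε n : ℝ)).congr_of_eventuallyEq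
            (Eventually.of_forall fun y => by simp [Complex.real_smul])
        have hdd := ((convolution_normed_contDiff (ρ n)
          (extendZero_locallyIntegrable u)).differentiable (by simp)
          (((1 - ε n : ℝ) : ℂ) * z)).hasFDerivAt.comp z hd
        have hin : ‖((1 - ε n : ℝ) : ℂ) * z‖ + (ρ n).rOut < 1 := by
          rw [norm_mul, Complex.norm_real, Real.norm_eq_abs, abs_of_nonneg (by linarith [hε1 n])]
          simp only [ρ]
          nlinarith [hε0 n, hε1 n, norm_nonneg z]
        have := fderiv_convolution_of_hasWeakDeriv (ρ n) hw hin
        have h5 : fderiv ℝ (fun z => ((ρ n).normed volume ⋆[lsmul ℝ ℝ, volume]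
          extendZero u) ((1 - ε n : ℝ) * z)) z e = (1 - ε n : ℝ) •
            ((ρ n).normed volume ⋆[lsmul ℝ ℝ, volume] extendZero w) ((1 - ε n : ℝ) * z) := by
          rw [← this]
          have h6 := hdd.fderiv
          simp only [Function.comp_def] at h6
          rw [h6]
          simp
        rw [h5]
        simp only [Pi.add_apply, Pi.smul_apply, Complex.real_smul]
        push_cast
        ring
      rw [eLpNorm_congr_ae e1]
      refine (eLpNorm_add_le ?_ ?_ one_le_two).trans (add_le_add ?_ ?_)
      · exact (((by fun_prop : Continuous fun z =>
          ((ρ n).normed volume ⋆[lsmul ℝ ℝ, volume] extendZero w)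
          ((1 - ε n : ℝ) * z)).aestronglyMeasurable).sub
          (Lp.aestronglyMeasurable w)).const_smul _
      · exact (Lp.aestronglyMeasurable w).const_smul _
      · rw [eLpNorm_const_smul]
        refine mul_le_of_le_one_left' ?_
        rw [← ofReal_norm, ENNReal.ofReal_le_one, Real.norm_eq_abs,
          abs_of_nonneg (by linarith [hε1 n])]
        linarith [hε0 n]
      · rw [eLpNorm_const_smul]
        gcongr
        rw [← ofReal_norm, Real.norm_eq_abs, abs_neg, abs_of_pos (hε0 n)]
    refine tendsto_of_tendsto_of_tendsto_of_le_of_le tendsto_const_nhds ?_ (fun _ => zero_le) hbd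
    have ht := ENNReal.Tendsto.mul_const (b := eLpNorm w 2 discMeasure)
      (ENNReal.tendsto_ofReal hεt) (Or.inr (Lp.memLp w).eLpNorm_ne_top)
    simpa using (hmol w).add ht

/-! ### Traces on the circle -/

/-- Sum the one-mode identities; the shifts `n ∓ 1` are bijections of `ℤ`, so Parseval still
applies. -/
lemma hasSum_int_mul_norm_sq_mode {φ : ℂ → ℂ} (hφ : ContDiff ℝ 1 φ) :
    HasSum (fun n : ℤ => (n : ℝ) * ‖mode φ n 1‖ ^ 2)
      ((1 / Real.pi) * ((∫ z in disc, ‖dzFun φ z‖ ^ 2) - ∫ z in disc, ‖dzbarFun φ z‖ ^ 2)) := by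
  have h1 := (Equiv.subRight (1 : ℤ)).hasSum_iff.2 (hasSum_integral_mode (dzFun_continuous hφ))
  have h2 := (Equiv.addRight (1 : ℤ)).hasSum_iff.2 (hasSum_integral_mode (dzbarFun_continuous hφ))
  have h := (h1.sub h2).mul_left 2
  simp only [Function.comp_apply, Equiv.subRight_apply, Equiv.coe_addRight] at h
  simp_rw [int_mul_norm_sq_mode_one hφ]
  have e : (1 / Real.pi) * ((∫ z in disc, ‖dzFun φ z‖ ^ 2) - ∫ z in disc, ‖dzbarFun φ z‖ ^ 2) =
      2 * (1 / (2 * Real.pi) * (∫ z in disc, ‖dzFun φ z‖ ^ 2)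
        - 1 / (2 * Real.pi) * ∫ z in disc, ‖dzbarFun φ z‖ ^ 2) := by
    field_simp
  rw [e]
  exact h

lemma integral_mode_nonneg (w : ℂ → ℂ) (n : ℤ) :
    0 ≤ ∫ r in (0 : ℝ)..1, r * ‖mode w n r‖ ^ 2 :=
  intervalIntegral.integral_nonneg zero_le_one fun _ hr => mul_nonneg hr.1 (sq_nonneg _)

/-- The trace inequality in `H^{1/2}` for smooth functions. -/
lemma summable_weighted_mode {φ : ℂ → ℂ} (hφ : ContDiff ℝ 1 φ) :
    Summable (fun n : ℤ => (1 + |(n : ℝ)|) * ‖mode φ n 1‖ ^ 2) ∧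
    ∑' n : ℤ, (1 + |(n : ℝ)|) * ‖mode φ n 1‖ ^ 2 ≤ (1 / (2 * Real.pi)) *
      (3 * (∫ z in disc, ‖φ z‖ ^ 2) + 4 * (∫ z in disc, ‖dzFun φ z‖ ^ 2)
        + 4 * ∫ z in disc, ‖dzbarFun φ z‖ ^ 2) := by
  have h0 := hasSum_integral_mode hφ.continuous
  have h1 := (Equiv.subRight (1 : ℤ)).hasSum_iff.2 (hasSum_integral_mode (dzFun_continuous hφ))
  have h2 := (Equiv.addRight (1 : ℤ)).hasSum_iff.2 (hasSum_integral_mode (dzbarFun_continuous hφ))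
  have h := ((h0.mul_left 3).add (h1.mul_left 4)).add (h2.mul_left 4)
  simp only [Function.comp_apply, Equiv.subRight_apply, Equiv.coe_addRight] at h
  -- Each `4` is `2` from `norm_sq_mode_one_le` plus `2` from the absolute value of
  -- `int_mul_norm_sq_mode_one`.
  have hle : ∀ n : ℤ, (1 + |(n : ℝ)|) * ‖mode φ n 1‖ ^ 2 ≤
      3 * (∫ r in (0 : ℝ)..1, r * ‖mode φ n r‖ ^ 2)
      + 4 * (∫ r in (0 : ℝ)..1, r * ‖mode (dzFun φ) (n - 1) r‖ ^ 2)
      + 4 * ∫ r in (0 : ℝ)..1, r * ‖mode (dzbarFun φ) (n + 1) r‖ ^ 2 := by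
    intro n
    have a := norm_sq_mode_one_le hφ n
    have b := int_mul_norm_sq_mode_one hφ n
    have p1 := integral_mode_nonneg (dzFun φ) (n - 1)
    have p2 := integral_mode_nonneg (dzbarFun φ) (n + 1)
    have c : |(n : ℝ)| * ‖mode φ n 1‖ ^ 2 = |(n : ℝ) * ‖mode φ n 1‖ ^ 2| := by
      rw [abs_mul, abs_of_nonneg (sq_nonneg ‖mode φ n 1‖)]
    rw [add_mul, one_mul, c, b]
    have : |2 * ((∫ r in (0 : ℝ)..1, r * ‖mode (dzFun φ) (n - 1) r‖ ^ 2)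
        - ∫ r in (0 : ℝ)..1, r * ‖mode (dzbarFun φ) (n + 1) r‖ ^ 2)| ≤
        2 * (∫ r in (0 : ℝ)..1, r * ‖mode (dzFun φ) (n - 1) r‖ ^ 2)
        + 2 * ∫ r in (0 : ℝ)..1, r * ‖mode (dzbarFun φ) (n + 1) r‖ ^ 2 := by
      rw [abs_le]; constructor <;> linarith
    linarith
  have hs : Summable (fun n : ℤ => (1 + |(n : ℝ)|) * ‖mode φ n 1‖ ^ 2) :=
    Summable.of_nonneg_of_le (fun n => by positivity) hle h.summable
  refine ⟨hs, (hs.tsum_le_tsum hle h.summable).trans (le_of_eq ?_)⟩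
  rw [h.tsum_eq]
  ring

/-! ### From smooth functions to `H¹`: completeness and limits -/

lemma norm_sq_lp_two {ι : Type*} (X : lp (fun _ : ι => ℂ) 2) : ‖X‖ ^ 2 = ∑' n, ‖X n‖ ^ 2 := by
  have h := lp.norm_rpow_eq_tsum (p := 2) (by simp) X
  simpa using h

lemma memℓp_two_iff {ι : Type*} {E : ι → Type*} [∀ i, NormedAddCommGroup (E i)]
    {x : ∀ i, E i} : Memℓp x 2 ↔ Summable fun n => ‖x n‖ ^ 2 := by
  rw [memℓp_gen_iff (by simp)]
  simp

/-- Completeness of weighted `ℓ²`. -/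
lemma tendsto_tsum_weighted {ι : Type*} {wt : ι → ℝ} (hwt : ∀ n, 0 ≤ wt n)
    {x : ℕ → ι → ℂ} {y : ι → ℂ}
    (hs : ∀ m, Summable fun n => wt n * ‖x m n‖ ^ 2)
    (hc : ∀ ε > 0, ∃ N, ∀ m ≥ N, ∀ k ≥ N, ∑' n, wt n * ‖x m n - x k n‖ ^ 2 < ε)
    (hlim : ∀ n, Tendsto (fun m => x m n) atTop (𝓝 (y n))) :
    Summable (fun n => wt n * ‖y n‖ ^ 2) ∧
      Tendsto (fun m => ∑' n, wt n * ‖x m n‖ ^ 2) atTop (𝓝 (∑' n, wt n * ‖y n‖ ^ 2)) := by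
  have hsq : ∀ (n : ι) (a : ℂ), ‖(√(wt n) : ℂ) * a‖ ^ 2 = wt n * ‖a‖ ^ 2 := by
    intro n a
    rw [norm_mul, mul_pow, Complex.norm_real, Real.norm_eq_abs, sq_abs, Real.sq_sqrt (hwt n)]
  -- Multiplication by `√wt` carries the problem to the complete space `ℓ²`; the limit there is
  -- identified entry by entry.
  let X : ℕ → lp (fun _ : ι => ℂ) 2 := fun m =>
    ⟨fun n => (√(wt n) : ℂ) * x m n, memℓp_two_iff.2 (by simpa only [hsq] using hs m)⟩
  have hX : ∀ m n, X m n = (√(wt n) : ℂ) * x m n := fun m n => rfl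
  have hcau : CauchySeq X := by
    rw [Metric.cauchySeq_iff]
    intro ε hε
    obtain ⟨N, hN⟩ := hc (ε ^ 2) (by positivity)
    refine ⟨N, fun m hm k hk => ?_⟩
    rw [dist_eq_norm]
    refine lt_of_pow_lt_pow_left₀ 2 hε.le ?_
    rw [norm_sq_lp_two]
    have e : ∀ n, ‖(X m - X k) n‖ ^ 2 = wt n * ‖x m n - x k n‖ ^ 2 := fun n => by
      rw [lp.coeFn_sub, Pi.sub_apply, hX, hX, ← mul_sub, hsq]
    simpa only [e] using hN m hm k hk
  obtain ⟨Y, hY⟩ := cauchySeq_tendsto_of_complete hcau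
  have hYy : ∀ n, Y n = (√(wt n) : ℂ) * y n := by
    intro n
    have h1 : Tendsto (fun m => X m n) atTop (𝓝 (Y n)) := by
      rw [tendsto_iff_norm_sub_tendsto_zero] at hY ⊢
      refine squeeze_zero (fun _ => norm_nonneg _) (fun m => ?_) hY
      exact lp.norm_apply_le_norm two_ne_zero (X m - Y) n
    exact tendsto_nhds_unique h1 ((hlim n).const_mul _)
  refine ⟨?_, ?_⟩
  · have := memℓp_two_iff.1 (lp.memℓp Y)
    simpa only [hYy, hsq] using this
  · have := (hY.norm.pow 2)
    simpa only [norm_sq_lp_two, hYy, hX, hsq] using this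

lemma memLp_disc_of_continuous {F : ℂ → ℂ} (hF : Continuous F) : MemLp F 2 discMeasure := by
  obtain ⟨C, hC⟩ := (isCompact_closedBall (0 : ℂ) 1).exists_bound_of_continuousOn hF.continuousOn
  have : IsFiniteMeasure discMeasure := ⟨by
    rw [Measure.restrict_apply_univ]; exact measure_ball_lt_top⟩
  refine MemLp.of_bound hF.aestronglyMeasurable C ?_
  filter_upwards [ae_restrict_mem measurableSet_ball] with z hz
  exact hC z (Metric.ball_subset_closedBall hz)

lemma norm_sq_L2 {X : Type*} [MeasurableSpace X] {μ : Measure X} (u : Lp ℂ 2 μ) :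
    ‖u‖ ^ 2 = ∫ z, ‖u z‖ ^ 2 ∂μ := by
  have h := congrArg RCLike.re (L2.inner_def (𝕜 := ℂ) u u)
  rw [← integral_re (L2.integrable_inner u u)] at h
  simpa only [← norm_sq_eq_re_inner] using h

lemma norm_sq_toLp {X : Type*} [MeasurableSpace X] {μ : Measure X} {F : X → ℂ}
    (hF : MemLp F 2 μ) : ‖hF.toLp‖ ^ 2 = ∫ z, ‖F z‖ ^ 2 ∂μ := by
  rw [norm_sq_L2]
  apply integral_congr_ae
  filter_upwards [hF.coeFn_toLp] with z hz
  rw [hz]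

lemma tendsto_toLp_of_eLpNorm {X : Type*} [MeasurableSpace X] {μ : Measure X} {F : ℕ → X → ℂ}
    (hF : ∀ m, MemLp (F m) 2 μ) {w : Lp ℂ 2 μ} :
    Tendsto (fun m => (hF m).toLp) atTop (𝓝 w) ↔
      Tendsto (fun m => eLpNorm (fun z => F m z - w z) 2 μ) atTop (𝓝 0) := by
  rw [Lp.tendsto_Lp_iff_tendsto_eLpNorm']
  have : ∀ m, eLpNorm (⇑((hF m).toLp) - ⇑w) 2 μ = eLpNorm (fun z => F m z - w z) 2 μ := by
    intro m
    apply eLpNorm_congr_ae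
    filter_upwards [(hF m).coeFn_toLp] with z hz
    rw [Pi.sub_apply, hz]
  simp_rw [this]

/-- The class in `L²(Ω)` of a continuous function. -/
def discLp {F : ℂ → ℂ} (hF : Continuous F) : L2Disc := (memLp_disc_of_continuous hF).toLp

lemma circle_memLp {φ : ℂ → ℂ} (hφ : Continuous φ) :
    MemLp (fun β : AddCircle (2 * Real.pi) => φ (AddCircle.toCircle β : ℂ)) 2
      AddCircle.haarAddCircle := by
  have hc : Continuous fun β : AddCircle (2 * Real.pi) => φ (AddCircle.toCircle β : ℂ) := by
    have := AddCircle.continuous_toCircle (T := 2 * Real.pi)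
    fun_prop
  exact MemLp.of_bound hc.aestronglyMeasurable _ (ae_of_all _ fun x =>
      ContinuousMap.norm_coe_le_norm ⟨_, hc⟩ x)

/-- The restriction to `Γ` of a continuous function, as an element of `L²(Γ)`. -/
def circleLp {φ : ℂ → ℂ} (hφ : Continuous φ) : L2Circle := (circle_memLp hφ).toLp

lemma coeff_circleLp {φ : ℂ → ℂ} (hφ : Continuous φ) (n : ℤ) :
    coeff (circleLp hφ) n = mode φ n 1 := by
  rw [coeff, circleLp, fourierCoeff_congr_ae (circle_memLp hφ).coeFn_toLp, mode_eq_fourierCoeff]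
  simp

lemma hasSum_norm_sq_coeff (g : L2Circle) : HasSum (fun n => ‖coeff g n‖ ^ 2) (‖g‖ ^ 2) := by
  rw [norm_sq_L2]
  exact hasSum_sq_fourierCoeff g

lemma coeff_sub (g h : L2Circle) (n : ℤ) : coeff (g - h) n = coeff g n - coeff h n := by
  simp only [coeff, ← fourierBasis_repr, map_sub, lp.coeFn_sub, Pi.sub_apply]

lemma norm_coeff_le (g : L2Circle) (n : ℤ) : ‖coeff g n‖ ≤ ‖g‖ := by
  refine le_of_sq_le_sq ?_ (norm_nonneg _)
  exact le_hasSum (hasSum_norm_sq_coeff g) n fun _ _ => sq_nonneg _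

lemma tendsto_coeff {G : ℕ → L2Circle} {g : L2Circle} (h : Tendsto G atTop (𝓝 g)) (n : ℤ) :
    Tendsto (fun m => coeff (G m) n) atTop (𝓝 (coeff g n)) := by
  rw [tendsto_iff_norm_sub_tendsto_zero] at h ⊢
  refine squeeze_zero (fun _ => norm_nonneg _) (fun m => ?_) h
  rw [← coeff_sub]
  exact norm_coeff_le _ n

lemma dzFun_sub {φ ψ : ℂ → ℂ} (hφ : ContDiff ℝ 1 φ) (hψ : ContDiff ℝ 1 ψ) :
    dzFun (φ - ψ) = dzFun φ - dzFun ψ := by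
  ext z
  simp only [dzFun, Pi.sub_apply]
  rw [fderiv_sub (hφ.differentiable one_ne_zero z) (hψ.differentiable one_ne_zero z)]
  simp only [sub_apply]
  ring

lemma dzbarFun_sub {φ ψ : ℂ → ℂ} (hφ : ContDiff ℝ 1 φ) (hψ : ContDiff ℝ 1 ψ) :
    dzbarFun (φ - ψ) = dzbarFun φ - dzbarFun ψ := by
  ext z
  simp only [dzbarFun, Pi.sub_apply]
  rw [fderiv_sub (hφ.differentiable one_ne_zero z) (hψ.differentiable one_ne_zero z)]
  simp only [sub_apply]
  ring

lemma setIntegral_norm_sq_eq {F : ℂ → ℂ} (hF : Continuous F) :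
    ∫ z in disc, ‖F z‖ ^ 2 = ‖discLp hF‖ ^ 2 :=
  (norm_sq_toLp (memLp_disc_of_continuous hF)).symm

lemma discLp_sub {F G : ℂ → ℂ} (hF : Continuous F) (hG : Continuous G) :
    discLp (hF.sub hG) = discLp hF - discLp hG :=
  MemLp.toLp_sub _ _

lemma circleLp_sub {F G : ℂ → ℂ} (hF : Continuous F) (hG : Continuous G) :
    circleLp (hF.sub hG) = circleLp hF - circleLp hG :=
  MemLp.toLp_sub _ _

/-- The `H^{1/2}` distance of the restrictions of two smooth functions to `Γ`. -/
lemma weighted_coeff_sub_le {φ ψ : ℂ → ℂ} (hφ : ContDiff ℝ 1 φ) (hψ : ContDiff ℝ 1 ψ) :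
    Summable (fun n : ℤ => (1 + |(n : ℝ)|) *
      ‖coeff (circleLp hφ.continuous) n - coeff (circleLp hψ.continuous) n‖ ^ 2) ∧
    ∑' n : ℤ, (1 + |(n : ℝ)|) *
      ‖coeff (circleLp hφ.continuous) n - coeff (circleLp hψ.continuous) n‖ ^ 2 ≤
    (1 / (2 * Real.pi)) * (3 * ‖discLp hφ.continuous - discLp hψ.continuous‖ ^ 2
      + 4 * ‖discLp (dzFun_continuous hφ) - discLp (dzFun_continuous hψ)‖ ^ 2
      + 4 * ‖discLp (dzbarFun_continuous hφ) - discLp (dzbarFun_continuous hψ)‖ ^ 2) := by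
  have h := summable_weighted_mode (hφ.sub hψ)
  have e1 : ∀ n, mode (fun z => φ z - ψ z) n 1 =
      coeff (circleLp hφ.continuous) n - coeff (circleLp hψ.continuous) n := by
    intro n
    rw [← coeff_sub, ← circleLp_sub, coeff_circleLp]
    rfl
  have e2 : dzFun (fun z => φ z - ψ z) = dzFun φ - dzFun ψ := dzFun_sub hφ hψ
  have e3 : dzbarFun (fun z => φ z - ψ z) = dzbarFun φ - dzbarFun ψ := dzbarFun_sub hφ hψ
  have i1 := setIntegral_norm_sq_eq (hφ.continuous.sub hψ.continuous)
  have i2 := setIntegral_norm_sq_eq ((dzFun_continuous hφ).sub (dzFun_continuous hψ))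
  have i3 := setIntegral_norm_sq_eq ((dzbarFun_continuous hφ).sub (dzbarFun_continuous hψ))
  rw [discLp_sub hφ.continuous hψ.continuous] at i1
  rw [discLp_sub (dzFun_continuous hφ) (dzFun_continuous hψ)] at i2
  rw [discLp_sub (dzbarFun_continuous hφ) (dzbarFun_continuous hψ)] at i3
  simp only [Pi.sub_apply] at i1 i2 i3
  simp only [e1, e2, e3, Pi.sub_apply] at h
  rw [i1, i2, i3] at h
  exact h

lemma norm_sq_circleLp_sub_le {φ ψ : ℂ → ℂ} (hφ : ContDiff ℝ 1 φ) (hψ : ContDiff ℝ 1 ψ) :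
    ‖circleLp hφ.continuous - circleLp hψ.continuous‖ ^ 2 ≤
    (1 / (2 * Real.pi)) * (3 * ‖discLp hφ.continuous - discLp hψ.continuous‖ ^ 2
      + 4 * ‖discLp (dzFun_continuous hφ) - discLp (dzFun_continuous hψ)‖ ^ 2
      + 4 * ‖discLp (dzbarFun_continuous hφ) - discLp (dzbarFun_continuous hψ)‖ ^ 2) := by
  have h := weighted_coeff_sub_le hφ hψ
  have hs := hasSum_norm_sq_coeff (circleLp hφ.continuous - circleLp hψ.continuous)
  simp_rw [coeff_sub] at hs
  refine (hasSum_le (fun n => ?_) hs h.1.hasSum).trans h.2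
  nlinarith [abs_nonneg (n : ℝ), sq_nonneg
    ‖coeff (circleLp hφ.continuous) n - coeff (circleLp hψ.continuous) n‖]

/-- `φ` is a sequence of smooth functions that converges to `u` in `H¹(Ω)`. -/
def ApproxH1 (φ : ℕ → ℂ → ℂ) (u : L2Disc) : Prop :=
  Tendsto (fun n => eLpNorm (fun z => φ n z - u z) 2 discMeasure) atTop (𝓝 0) ∧
    (∀ e ∈ ({1, I} : Set ℂ),
      Tendsto (fun n => eLpNorm (fun z => fderiv ℝ (φ n) z e - weakDeriv e u z) 2 discMeasure)
        atTop (𝓝 0))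

lemma ApproxH1.tendsto {φ : ℕ → ℂ → ℂ} {u : L2Disc} (h : ApproxH1 φ u)
    (hφ : ∀ n, ContDiff ℝ 1 (φ n)) :
    Tendsto (fun n => discLp (hφ n).continuous) atTop (𝓝 u) ∧
    Tendsto (fun n => discLp (dzFun_continuous (hφ n))) atTop (𝓝 (dz u)) ∧
    Tendsto (fun n => discLp (dzbarFun_continuous (hφ n))) atTop (𝓝 (dzbar u)) := by
  have hc : ∀ n e, Continuous fun z => fderiv ℝ (φ n) z e := fun n e => by
    have := (hφ n).continuous_fderiv one_ne_zero
    fun_prop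
  have h1 : Tendsto (fun n => discLp (hc n 1)) atTop (𝓝 (weakDeriv 1 u)) :=
    (tendsto_toLp_of_eLpNorm _).2 (h.2 1 (by simp))
  have hI : Tendsto (fun n => discLp (hc n I)) atTop (𝓝 (weakDeriv I u)) :=
    (tendsto_toLp_of_eLpNorm _).2 (h.2 I (by simp))
  refine ⟨(tendsto_toLp_of_eLpNorm _).2 h.1, ?_, ?_⟩
  · have e : ∀ n, discLp (dzFun_continuous (hφ n)) =
        (1 / 2 : ℂ) • (discLp (hc n 1) - I • discLp (hc n I)) := by
      intro n
      simp only [discLp]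
      rw [← MemLp.toLp_const_smul, ← MemLp.toLp_sub, ← MemLp.toLp_const_smul]
      rfl
    simp_rw [e]
    exact (h1.sub (hI.const_smul I)).const_smul _
  · have e : ∀ n, discLp (dzbarFun_continuous (hφ n)) =
        (1 / 2 : ℂ) • (discLp (hc n 1) + I • discLp (hc n I)) := by
      intro n
      simp only [discLp]
      rw [← MemLp.toLp_const_smul, ← MemLp.toLp_add, ← MemLp.toLp_const_smul]
      rfl
    simp_rw [e]
    exact (h1.add (hI.const_smul I)).const_smul _

lemma tendsto_norm_sub_sq {E : Type*} [SeminormedAddCommGroup E] {x y : ℕ × ℕ → E} {a : E}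
    (hx : Tendsto x atTop (𝓝 a)) (hy : Tendsto y atTop (𝓝 a)) :
    Tendsto (fun p => ‖x p - y p‖ ^ 2) atTop (𝓝 0) := by
  simpa using (hx.sub hy).norm.pow 2

/-- Two sequences that converge to the same `u` in `H¹(Ω)` have the same boundary behaviour. -/
lemma ApproxH1.tendsto_bound {φ ψ : ℕ → ℂ → ℂ} {u : L2Disc} (h : ApproxH1 φ u) (h' : ApproxH1 ψ u)
    (hφ : ∀ n, ContDiff ℝ 1 (φ n)) (hψ : ∀ n, ContDiff ℝ 1 (ψ n)) :
    Tendsto (fun p : ℕ × ℕ => (1 / (2 * Real.pi)) *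
      (3 * ‖discLp (hφ p.1).continuous - discLp (hψ p.2).continuous‖ ^ 2
      + 4 * ‖discLp (dzFun_continuous (hφ p.1)) - discLp (dzFun_continuous (hψ p.2))‖ ^ 2
      + 4 * ‖discLp (dzbarFun_continuous (hφ p.1)) - discLp (dzbarFun_continuous (hψ p.2))‖ ^ 2))
      atTop (𝓝 0) := by
  obtain ⟨a1, a2, a3⟩ := h.tendsto hφ
  obtain ⟨b1, b2, b3⟩ := h'.tendsto hψ
  have tf : Tendsto (Prod.fst : ℕ × ℕ → ℕ) atTop atTop := by
    rw [← prod_atTop_atTop_eq]; exact tendsto_fst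
  have ts : Tendsto (Prod.snd : ℕ × ℕ → ℕ) atTop atTop := by
    rw [← prod_atTop_atTop_eq]; exact tendsto_snd
  have := (((tendsto_norm_sub_sq (a1.comp tf) (b1.comp ts)).const_mul 3).add
    ((tendsto_norm_sub_sq (a2.comp tf) (b2.comp ts)).const_mul 4)).add
    ((tendsto_norm_sub_sq (a3.comp tf) (b3.comp ts)).const_mul 4)
  simpa using this.const_mul (1 / (2 * Real.pi))

lemma ApproxH1.tendsto_circleLp {φ ψ : ℕ → ℂ → ℂ} {u : L2Disc} (h : ApproxH1 φ u)
    (h' : ApproxH1 ψ u) (hφ : ∀ n, ContDiff ℝ 1 (φ n)) (hψ : ∀ n, ContDiff ℝ 1 (ψ n)) :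
    Tendsto (fun p : ℕ × ℕ => ‖circleLp (hφ p.1).continuous - circleLp (hψ p.2).continuous‖ ^ 2)
      atTop (𝓝 0) :=
  squeeze_zero (fun _ => sq_nonneg _) (fun p => norm_sq_circleLp_sub_le (hφ p.1) (hψ p.2))
    (h.tendsto_bound h' hφ hψ)

lemma isTrace_iff (u : L2Disc) (g : L2Circle) :
    IsTrace u g ↔ ∃ (φ : ℕ → ℂ → ℂ) (hφ : ∀ n, ContDiff ℝ ∞ (φ n)), ApproxH1 φ u ∧
      Tendsto (fun n => circleLp (hφ n).continuous) atTop (𝓝 g) := by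
  constructor
  · rintro ⟨φ, h1, h2, h3, h4⟩
    exact ⟨φ, h1, ⟨h2, h3⟩, (tendsto_toLp_of_eLpNorm _).2 h4⟩
  · rintro ⟨φ, h1, ⟨h2, h3⟩, h4⟩
    exact ⟨φ, h1, h2, h3, (tendsto_toLp_of_eLpNorm _).1 h4⟩

/-- Existence and uniqueness of the trace, the trace inequality in `H^{1/2}`, and Green's
identity. -/
theorem exists_trace (u : L2Disc) (hu : IsH1 u) :
    ∃ g : L2Circle, (∀ h, IsTrace u h ↔ h = g) ∧
      Summable (fun n : ℤ => (1 + |(n : ℝ)|) * ‖coeff g n‖ ^ 2) ∧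
      ∑' n : ℤ, (1 + |(n : ℝ)|) * ‖coeff g n‖ ^ 2 ≤
        (1 / (2 * Real.pi)) * (3 * ‖u‖ ^ 2 + 4 * ‖dz u‖ ^ 2 + 4 * ‖dzbar u‖ ^ 2) ∧
      HasSum (fun n : ℤ => (n : ℝ) * ‖coeff g n‖ ^ 2)
        ((1 / Real.pi) * (‖dz u‖ ^ 2 - ‖dzbar u‖ ^ 2)) := by
  obtain ⟨φ, hφ, ha1, ha2⟩ := exists_smooth_approximation u hu
  have ha : ApproxH1 φ u := ⟨ha1, ha2⟩
  have hφ1 : ∀ n, ContDiff ℝ 1 (φ n) := fun n => (hφ n).of_le (by simp)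
  have hcau : CauchySeq fun n => circleLp (hφ n).continuous := by
    rw [Metric.cauchySeq_iff]
    intro ε hε
    have := (ha.tendsto_circleLp ha hφ1 hφ1).eventually (gt_mem_nhds (pow_pos hε 2))
    rw [eventually_atTop_prod_self'] at this
    obtain ⟨N, hN⟩ := this
    refine ⟨N, fun m hm k hk => ?_⟩
    rw [dist_eq_norm]
    exact lt_of_pow_lt_pow_left₀ 2 hε.le (hN m hm k hk)
  obtain ⟨g, hg⟩ := cauchySeq_tendsto_of_complete hcau
  have hcoeff := fun n => tendsto_coeff hg n
  have hsm : ∀ m, Summable fun n : ℤ =>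
      (1 + |(n : ℝ)|) * ‖coeff (circleLp (hφ m).continuous) n‖ ^ 2 := by
    intro m
    simp_rw [coeff_circleLp]
    exact (summable_weighted_mode (hφ1 m)).1
  have hcw : ∀ ε > 0, ∃ N, ∀ m ≥ N, ∀ k ≥ N, ∑' n : ℤ, (1 + |(n : ℝ)|) *
      ‖coeff (circleLp (hφ m).continuous) n - coeff (circleLp (hφ k).continuous) n‖ ^ 2 < ε := by
    intro ε hε
    have := (ha.tendsto_bound ha hφ1 hφ1).eventually (gt_mem_nhds hε)
    rw [eventually_atTop_prod_self'] at this
    obtain ⟨N, hN⟩ := this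
    exact ⟨N, fun m hm k hk =>
      (weighted_coeff_sub_le (hφ1 m) (hφ1 k)).2.trans_lt (hN m hm k hk)⟩
  obtain ⟨hs1, ht1⟩ := tendsto_tsum_weighted (wt := fun n : ℤ => 1 + |(n : ℝ)|)
    (fun n => by positivity) hsm hcw hcoeff
  -- The weight `n` of Green's identity changes sign. It is the difference of the nonnegative
  -- weights `1 + |n| + n` and `1 + |n|`, and the limit is taken in each separately.
  have hle2 : ∀ n : ℤ, ∀ a : ℂ,
      (1 + |(n : ℝ)| + n) * ‖a‖ ^ 2 ≤ 2 * ((1 + |(n : ℝ)|) * ‖a‖ ^ 2) := by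
    intro n a
    nlinarith [le_abs_self (n : ℝ), sq_nonneg ‖a‖]
  have hwt2 : ∀ n : ℤ, 0 ≤ 1 + |(n : ℝ)| + n := fun n => by linarith [neg_abs_le (n : ℝ)]
  have hsm2 : ∀ m, Summable fun n : ℤ =>
      (1 + |(n : ℝ)| + n) * ‖coeff (circleLp (hφ m).continuous) n‖ ^ 2 := fun m =>
    Summable.of_nonneg_of_le (fun n => mul_nonneg (hwt2 n) (sq_nonneg _)) (fun n => hle2 n _)
      ((hsm m).mul_left 2)
  have hcw2 : ∀ ε > 0, ∃ N, ∀ m ≥ N, ∀ k ≥ N, ∑' n : ℤ, (1 + |(n : ℝ)| + n) *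
      ‖coeff (circleLp (hφ m).continuous) n - coeff (circleLp (hφ k).continuous) n‖ ^ 2 < ε := by
    intro ε hε
    obtain ⟨N, hN⟩ := hcw (ε / 2) (half_pos hε)
    refine ⟨N, fun m hm k hk => ?_⟩
    have hs := (weighted_coeff_sub_le (hφ1 m) (hφ1 k)).1.mul_left 2
    refine (Summable.tsum_le_tsum (fun n => hle2 n _) (Summable.of_nonneg_of_le
      (fun n => mul_nonneg (hwt2 n) (sq_nonneg _)) (fun n => hle2 n _) hs) hs).trans_lt ?_
    rw [tsum_mul_left]
    linarith [hN m hm k hk]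
  obtain ⟨hs2, ht2⟩ := tendsto_tsum_weighted hwt2 hsm2 hcw2 hcoeff
  obtain ⟨c0, c1, c2⟩ := ha.tendsto hφ1
  refine ⟨g, fun h => ?_, hs1, ?_, ?_⟩
  · rw [isTrace_iff]
    constructor
    · rintro ⟨ψ, hψ, hb, hh⟩
      have hψ1 : ∀ n, ContDiff ℝ 1 (ψ n) := fun n => (hψ n).of_le (by simp)
      have tf : Tendsto (Prod.fst : ℕ × ℕ → ℕ) atTop atTop := by
        rw [← prod_atTop_atTop_eq]; exact tendsto_fst
      have ts : Tendsto (Prod.snd : ℕ × ℕ → ℕ) atTop atTop := by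
        rw [← prod_atTop_atTop_eq]; exact tendsto_snd
      -- By the trace inequality for differences, any other approximating sequence has the same
      -- limit on `Γ`.
      have l1 := ((hh.comp tf).sub (hg.comp ts)).norm.pow 2
      have l2 := tendsto_nhds_unique l1 (hb.tendsto_circleLp ha hψ1 hφ1)
      rw [sq_eq_zero_iff, norm_eq_zero, sub_eq_zero] at l2
      exact l2
    · rintro rfl
      exact ⟨φ, hφ, ha, hg⟩
  · refine le_of_tendsto_of_tendsto ht1 ((((c0.norm.pow 2).const_mul 3).add
      ((c1.norm.pow 2).const_mul 4)).add ((c2.norm.pow 2).const_mul 4) |>.const_mul _)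
      (Eventually.of_forall fun m => ?_)
    have := (summable_weighted_mode (hφ1 m)).2
    simp only [coeff_circleLp]
    rwa [setIntegral_norm_sq_eq (hφ1 m).continuous,
      setIntegral_norm_sq_eq (dzFun_continuous (hφ1 m)),
      setIntegral_norm_sq_eq (dzbarFun_continuous (hφ1 m))] at this
  · have hd : HasSum (fun n : ℤ => (n : ℝ) * ‖coeff g n‖ ^ 2)
        ((∑' n : ℤ, (1 + |(n : ℝ)| + n) * ‖coeff g n‖ ^ 2)
          - ∑' n : ℤ, (1 + |(n : ℝ)|) * ‖coeff g n‖ ^ 2) := by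
      refine (hs2.hasSum.sub hs1.hasSum).congr_fun fun n => ?_
      ring
    have hlim : Tendsto (fun m => (1 / Real.pi) * (‖discLp (dzFun_continuous (hφ1 m))‖ ^ 2
        - ‖discLp (dzbarFun_continuous (hφ1 m))‖ ^ 2)) atTop
        (𝓝 ((∑' n : ℤ, (1 + |(n : ℝ)| + n) * ‖coeff g n‖ ^ 2)
          - ∑' n : ℤ, (1 + |(n : ℝ)|) * ‖coeff g n‖ ^ 2)) := by
      refine (ht2.sub ht1).congr fun m => ?_
      have h1 := hasSum_int_mul_norm_sq_mode (hφ1 m)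
      rw [setIntegral_norm_sq_eq (dzFun_continuous (hφ1 m)),
        setIntegral_norm_sq_eq (dzbarFun_continuous (hφ1 m))] at h1
      rw [← h1.tsum_eq, ← (hsm2 m).tsum_sub (hsm m)]
      congr 1
      ext n
      rw [coeff_circleLp]
      ring
    rw [tendsto_nhds_unique (((c1.norm.pow 2).sub (c2.norm.pow 2)).const_mul (1 / Real.pi)) hlim]
    exact hd

/-! ### Series of functions on the disc -/

/-- By Tonelli `∑ ‖F i‖` has finite integral, so it is finite almost everywhere and dominates the
sum. -/
lemma ae_summable_of_summable_integral_norm {X ι E : Type*} [MeasurableSpace X] {μ : Measure X}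
    [Countable ι] [NormedAddCommGroup E] [NormedSpace ℝ E] [CompleteSpace E] {F : ι → X → E}
    (hF : ∀ i, Integrable (F i) μ) (hs : Summable fun i => ∫ x, ‖F i x‖ ∂μ) :
    (∀ᵐ x ∂μ, Summable fun i => ‖F i x‖) ∧ Integrable (fun x => ∑' i, F i x) μ := by
  have hm : ∀ i, AEMeasurable (fun x => ‖F i x‖ₑ) μ := fun i => (hF i).aestronglyMeasurable.enorm
  have hfin : ∫⁻ x, ∑' i, ‖F i x‖ₑ ∂μ < ⊤ := by
    rw [lintegral_tsum hm]
    have (i : ι) : ∫⁻ a, ‖F i a‖ₑ ∂μ = ENNReal.ofReal (∫ a, ‖F i a‖ ∂μ) :=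
      (ofReal_integral_norm_eq_lintegral_enorm (hF i)).symm
    simp_rw [this]
    rw [← ENNReal.ofReal_tsum_of_nonneg (fun i => integral_nonneg fun _ => norm_nonneg _) hs]
    exact ENNReal.ofReal_lt_top
  have hae : ∀ᵐ x ∂μ, Summable fun i => ‖F i x‖ := by
    filter_upwards [ae_lt_top' (AEMeasurable.tsum hm) hfin.ne] with x hx
    have h1 : ∑' i, ((‖F i x‖₊ : NNReal) : ℝ≥0∞) ≠ ⊤ := hx.ne
    have h2 := ENNReal.tsum_coe_ne_top_iff_summable.1 h1
    exact NNReal.summable_coe.2 h2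
  refine ⟨hae, ?_, ?_⟩
  · refine aestronglyMeasurable_of_tendsto_ae (atTop : Filter (Finset ι))
      (f := fun s x => ∑ i ∈ s, F i x)
      (fun s => Finset.aestronglyMeasurable_fun_sum s fun i _ => (hF i).aestronglyMeasurable) ?_
    filter_upwards [hae] with x hx
    exact hx.of_norm.hasSum
  · refine lt_of_le_of_lt (lintegral_mono_ae ?_) hfin
    filter_upwards [hae] with x hx
    exact enorm_tsum_le_tsum_enorm

/-! ### Shifted sequences and double series -/

lemma leftShift_iterate {X : Type*} (n : ℕ) (u : ℕ → X) :
    leftShift^[n] u = fun k => u (k + n) := by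
  induction n generalizing u with
  | zero => rfl
  | succ n ih =>
    rw [Function.iterate_succ_apply, ih]
    ext k
    simp only [leftShift]
    congr 1

/-- The entry of `L^{2j} u` with index `k` is the entry of `u` with this index. -/
def doubleIndex (p : ℕ × ℕ) : ℕ := p.2 + 2 * p.1

/-- If `m = k + 2j` then `j ≤ m`, and `j` determines `k`. So at most `m + 1` pairs share the index
`m`, which the weight `1 + m` pays for. -/
lemma summable_doubleIndex {a : ℕ → ℝ} (ha : ∀ m, 0 ≤ a m)
    (hs : Summable fun m : ℕ => (1 + (m : ℝ)) * a m) : Summable fun p => a (doubleIndex p) := by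
  let i : ℕ × ℕ → (Σ m : ℕ, Fin (m + 1)) := fun p => ⟨doubleIndex p, ⟨p.1, by
    simp only [doubleIndex]; omega⟩⟩
  have hi : Function.Injective i := by
    rintro ⟨j, k⟩ ⟨j', k'⟩ h
    simp only [i, doubleIndex, Sigma.mk.injEq] at h
    obtain ⟨h1, h2⟩ := h
    have h3 : j = j' := by
      have := (Fin.heq_ext_iff (by omega)).1 h2
      exact this
    ext <;> simp <;> omega
  have hsig : Summable fun q : (Σ m : ℕ, Fin (m + 1)) => a q.1 := by
    rw [summable_sigma_of_nonneg fun _ => ha _]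
    refine ⟨fun m => Summable.of_finite, hs.congr fun m => ?_⟩
    rw [tsum_fintype]
    simp [add_comm]
  exact hsig.comp_injective hi

/-- `x ∈ l^{2,1/2}(ℕ; L²(Ω))`. -/
def HalfSummable (x : ℕ → L2Disc) : Prop := Summable fun m : ℕ => (1 + (m : ℝ)) * ‖x m‖ ^ 2

lemma HalfSummable.summable {x : ℕ → L2Disc} (hx : HalfSummable x) :
    Summable fun m => ‖x m‖ ^ 2 :=
  Summable.of_nonneg_of_le (fun _ => sq_nonneg _) (fun m => by
    nlinarith [sq_nonneg ‖x m‖, (Nat.cast_nonneg m : (0 : ℝ) ≤ m)]) hx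

lemma HalfSummable.doubleIndex {x : ℕ → L2Disc} (hx : HalfSummable x) :
    Summable fun p => ‖x (doubleIndex p)‖ ^ 2 :=
  summable_doubleIndex (a := fun m => ‖x m‖ ^ 2) (fun _ => sq_nonneg _) hx

lemma HalfSummable.shift {x : ℕ → L2Disc} (hx : HalfSummable x) (n : ℕ) :
    HalfSummable (leftShift^[n] x) := by
  rw [leftShift_iterate]
  refine Summable.of_nonneg_of_le (fun _ => by positivity) (fun m => ?_)
    ((summable_nat_add_iff n).2 hx)
  push_cast
  gcongr
  linarith [(Nat.cast_nonneg n : (0 : ℝ) ≤ n)]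

lemma integrable_norm_sq (u : L2Disc) : Integrable (fun z => ‖u z‖ ^ 2) discMeasure :=
  (Lp.memLp u).integrable_norm_pow two_ne_zero

lemma integrable_mul_conj (x y : L2Disc) :
    Integrable (fun z => x z * conj (y z)) discMeasure := by
  have := L2.integrable_inner (𝕜 := ℂ) y x
  simpa only [RCLike.inner_apply] using this

lemma integral_mul_conj (x y : L2Disc) :
    ∫ z in disc, x z * conj (y z) = inner ℂ y x := by
  rw [L2.inner_def]
  simp only [RCLike.inner_apply]

lemma integral_norm_mul_conj_le (x y : L2Disc) :
    ∫ z in disc, ‖x z * conj (y z)‖ ≤ ‖x‖ ^ 2 + ‖y‖ ^ 2 := by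
  rw [norm_sq_L2, norm_sq_L2, ← integral_add (integrable_norm_sq x) (integrable_norm_sq y)]
  refine integral_mono (integrable_mul_conj x y).norm
    ((integrable_norm_sq x).add (integrable_norm_sq y)) fun z => ?_
  simp only [norm_mul, RCLike.norm_conj]
  nlinarith [sq_nonneg (‖x z‖ - ‖y z‖), sq_nonneg ‖x z‖, sq_nonneg ‖y z‖]

lemma innerTerm_eq (x y : ℕ → L2Disc) (j : ℕ) (z : ℂ) :
    innerTerm x y j z =
      (∑' k, x (doubleIndex (j, k)) z * conj (y (doubleIndex (j, k)) z)).re := by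
  simp only [innerTerm, l2Inner, evalAt, leftShift_iterate, doubleIndex]

lemma squareTerm_eq (w : ℕ → L2Disc) : squareTerm w = innerTerm w w := by
  ext j z
  simp only [squareTerm, innerTerm, l2NormSq, l2Inner, Complex.mul_conj, Complex.normSq_eq_norm_sq]
  rw [← Complex.ofReal_tsum, Complex.ofReal_re]

/-- Since `L^{2(j+1)} = L^{2j} L²`, the cross terms also fall under `converges_innerTerm`. -/
lemma crossTerm_eq (v w : ℕ → L2Disc) :
    crossTerm v w = innerTerm (leftShift^[2] (dzSeq v)) w := by
  ext j z
  rw [crossTerm, innerTerm, mul_add, mul_one, Function.iterate_add_apply]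

/-- Absolute convergence in `L¹` permits passing from the iterated sum over `j` and `k` to a sum
over pairs, and interchanging that sum with the integral. -/
lemma iterated_re_series_integral {X : Type*} [MeasurableSpace X] {μ : Measure X}
    {G : ℕ × ℕ → X → ℂ} (hint : ∀ p, Integrable (G p) μ)
    (hsum : Summable fun p => ∫ z, ‖G p z‖ ∂μ) :
    (∀ᵐ z ∂μ, HasSum (fun j => (∑' k, G (j, k) z).re) (∑' p, G p z).re) ∧
      Integrable (fun z => (∑' p, G p z).re) μ ∧
      HasSum (fun p => (∫ z, G p z ∂μ).re) (∫ z, (∑' p, G p z).re ∂μ) := by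
  obtain ⟨hae, hI⟩ := ae_summable_of_summable_integral_norm hint hsum
  refine ⟨?_, hI.re, ?_⟩
  · filter_upwards [hae] with z hz
    have hz' : Summable fun p => G p z := hz.of_norm
    have h1 : HasSum (fun j => ∑' k, G (j, k) z) (∑' p, G p z) := by
      rw [hz'.tsum_prod]
      exact hz'.prod.hasSum
    exact Complex.hasSum_re h1
  · have h2 := Complex.hasSum_re (hasSum_integral_of_summable_integral_norm hint hsum)
    have h3 : ∫ z, (∑' p, G p z).re ∂μ = (∫ z, ∑' p, G p z ∂μ).re := integral_re hI
    rw [h3]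
    exact h2

/-- The series `∑_j Re ⟨L^{2j} x, L^{2j} y⟩` converges in `L¹(Ω)`. -/
lemma converges_innerTerm {x y : ℕ → L2Disc} (hx : HalfSummable x) (hy : HalfSummable y) :
    Converges (innerTerm x y) ∧
      HasSum (fun p => (inner ℂ (x (doubleIndex p)) (y (doubleIndex p)) : ℂ).re)
        (integralSum (innerTerm x y)) := by
  have hsum : Summable fun p =>
      ∫ z in disc, ‖x (doubleIndex p) z * conj (y (doubleIndex p) z)‖ :=
    Summable.of_nonneg_of_le (fun p => integral_nonneg fun _ => norm_nonneg _)
      (fun p => integral_norm_mul_conj_le _ _)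
      (hx.doubleIndex.add hy.doubleIndex)
  obtain ⟨hpt, hI, hS⟩ := iterated_re_series_integral
    (fun p : ℕ × ℕ => integrable_mul_conj (x (doubleIndex p)) (y (doubleIndex p))) hsum
  simp only [← innerTerm_eq] at hpt
  have heq : (fun z => ∑' j, innerTerm x y j z) =ᵐ[discMeasure] fun z =>
      (∑' p, x (doubleIndex p) z * conj (y (doubleIndex p) z)).re := by
    filter_upwards [hpt] with z hz
    exact hz.tsum_eq
  have hae : ∀ᵐ z ∂discMeasure, Summable fun j => innerTerm x y j z :=
    hpt.mono fun z hz => hz.summable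
  refine ⟨⟨hae, hI.congr heq.symm⟩, ?_⟩
  rw [integralSum, integral_congr_ae heq]
  -- `inner` is conjugate linear in its first argument, so the arguments come out exchanged; the
  -- real part does not see this.
  have e : ∀ p : ℕ × ℕ, (inner ℂ (x (doubleIndex p)) (y (doubleIndex p)) : ℂ).re =
      (∫ z in disc, x (doubleIndex p) z * conj (y (doubleIndex p) z)).re := fun p => by
    rw [integral_mul_conj]
    exact inner_re_symm (𝕜 := ℂ) _ _
  simp only [e]
  exact hS

/-- A square summable sequence in `L²(Ω)` is almost everywhere in `ℓ²`. -/
lemma hasSum_integral_l2NormSq {x : ℕ → L2Disc} (hx : Summable fun m => ‖x m‖ ^ 2) :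
    (∀ᵐ z ∂discMeasure, Memℓp (evalAt x z) 2) ∧
    Integrable (fun z => l2NormSq (evalAt x z)) discMeasure ∧
    HasSum (fun m => ‖x m‖ ^ 2) (∫ z in disc, l2NormSq (evalAt x z)) := by
  have hs : Summable fun m => ∫ z in disc, ‖‖x m z‖ ^ 2‖ := by
    refine hx.congr fun m => ?_
    rw [norm_sq_L2]
    congr 1
    ext z
    rw [Real.norm_of_nonneg (sq_nonneg _)]
  obtain ⟨h1, h2⟩ := ae_summable_of_summable_integral_norm (fun m => integrable_norm_sq (x m)) hs
  refine ⟨?_, h2, ?_⟩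
  · filter_upwards [h1] with z hz
    rw [memℓp_two_iff]
    exact hz.of_norm
  · have := hasSum_integral_of_summable_integral_norm (fun m => integrable_norm_sq (x m)) hs
    simp only [← norm_sq_L2] at this
    exact this

/-- Adding `2` to the index moves `(j, k)` to `(j + 1, k)`, so only the row `j = 0`, where the index
is `k`, survives. -/
lemma tsum_doubleIndex_sub {a : ℕ → ℝ} (h : Summable fun p => a (doubleIndex p)) :
    ∑' p, a (doubleIndex p) - ∑' p, a (doubleIndex p + 2) = ∑' m, a m := by
  have hs2 : Summable fun p : ℕ × ℕ => a (doubleIndex p + 2) := by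
    have hi : Function.Injective fun p : ℕ × ℕ => (p.1 + 1, p.2) := by
      rintro ⟨j, k⟩ ⟨j', k'⟩ h
      simpa using h
    refine (h.comp_injective hi).congr fun p => ?_
    simp only [Function.comp_apply, doubleIndex]
    congr 1
  rw [h.tsum_prod, hs2.tsum_prod, h.prod.tsum_eq_zero_add]
  have e : ∀ j k, doubleIndex (j + 1, k) = doubleIndex (j, k) + 2 := by
    intro j k; simp only [doubleIndex]; ring
  simp only [e]
  simp [doubleIndex]

lemma norm_sq_dz_le (u : L2Disc) : ‖dz u‖ ^ 2 ≤ h1NormSq u := by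
  have h : ‖dz u‖ ≤ 1 / 2 * (‖weakDeriv 1 u‖ + ‖weakDeriv I u‖) := by
    rw [dz, norm_smul]
    have := norm_sub_le (weakDeriv 1 u) (I • weakDeriv I u)
    rw [norm_smul, Complex.norm_I, one_mul] at this
    simpa using this
  rw [h1NormSq]
  nlinarith [norm_nonneg (dz u), sq_nonneg (‖weakDeriv 1 u‖ - ‖weakDeriv I u‖), sq_nonneg ‖u‖]

lemma norm_sq_dzbar_le (u : L2Disc) : ‖dzbar u‖ ^ 2 ≤ h1NormSq u := by
  have h : ‖dzbar u‖ ≤ 1 / 2 * (‖weakDeriv 1 u‖ + ‖weakDeriv I u‖) := by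
    rw [dzbar, norm_smul]
    have := norm_add_le (weakDeriv 1 u) (I • weakDeriv I u)
    rw [norm_smul, Complex.norm_I, one_mul] at this
    simpa using this
  rw [h1NormSq]
  nlinarith [norm_nonneg (dzbar u), sq_nonneg (‖weakDeriv 1 u‖ - ‖weakDeriv I u‖), sq_nonneg ‖u‖]

lemma h1NormSq_nonneg (u : L2Disc) : 0 ≤ h1NormSq u := by unfold h1NormSq; positivity

lemma halfSummable_of_memSeqL2_one {x : ℕ → L2Disc} (hx : MemSeqL2 1 x) : HalfSummable x := by
  refine Summable.of_nonneg_of_le (fun _ => by positivity) (fun m => ?_) (hx.mul_left 2)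
  rw [Real.rpow_one, ← mul_assoc]
  gcongr
  nlinarith [sq_nonneg ((m : ℝ) - 1)]

/-- With `rpow_half_le_one_add`, this makes `1 + |t|` equivalent to the weight `(1 + t²)^{1/2}`. -/
lemma one_add_le_two_mul_rpow_half (t : ℝ) : 1 + |t| ≤ 2 * (1 + t ^ 2) ^ (1 / 2 : ℝ) := by
  rw [← Real.sqrt_eq_rpow]
  have h1 : 1 ≤ √(1 + t ^ 2) := Real.one_le_sqrt.2 (by nlinarith [sq_nonneg t])
  have h2 : |t| ≤ √(1 + t ^ 2) := Real.abs_le_sqrt (by linarith)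
  linarith

lemma rpow_half_le_one_add (t : ℝ) : (1 + t ^ 2) ^ (1 / 2 : ℝ) ≤ 1 + |t| := by
  rw [← Real.sqrt_eq_rpow, Real.sqrt_le_left (by positivity)]
  nlinarith [abs_nonneg t, sq_abs t]

lemma MemSeqH1.summable {v : ℕ → L2Disc} (hv : MemSeqH1 (1 / 2) v) :
    Summable fun m : ℕ => (1 + (m : ℝ)) * h1NormSq (v m) := by
  refine Summable.of_nonneg_of_le (fun m => mul_nonneg (by positivity) (h1NormSq_nonneg _))
    (fun m => ?_) (hv.2.mul_left 2)
  rw [← mul_assoc]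
  refine mul_le_mul_of_nonneg_right ?_ (h1NormSq_nonneg _)
  have := one_add_le_two_mul_rpow_half (m : ℝ)
  rwa [abs_of_nonneg (Nat.cast_nonneg m)] at this

lemma HalfSummable.of_le_h1NormSq {v x : ℕ → L2Disc} (hv : MemSeqH1 (1 / 2) v)
    (h : ∀ m, ‖x m‖ ^ 2 ≤ h1NormSq (v m)) : HalfSummable x :=
  Summable.of_nonneg_of_le (fun m => by positivity)
    (fun m => mul_le_mul_of_nonneg_left (h m) (by positivity)) hv.summable

/-! ### The boundary term -/

lemma coeff_mul_conj_tangentialDeriv (a : ℤ → ℂ) (n : ℤ) :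
    a n * conj (tangentialDeriv a n) = -I * ((n * ‖a n‖ ^ 2 : ℝ) : ℂ) := by
  simp only [tangentialDeriv, map_mul, Complex.conj_I, map_intCast]
  have h := Complex.mul_conj (a n)
  rw [Complex.normSq_eq_norm_sq] at h
  push_cast at h ⊢
  rw [← h]
  ring

/-- `2π · (-i) · s/π = -2i s`, which the prefactor `i/2` of the boundary term turns into `s`. -/
lemma circlePairing_tangentialDeriv {a : ℤ → ℂ} {s : ℝ}
    (h : HasSum (fun n : ℤ => (n : ℝ) * ‖a n‖ ^ 2) ((1 / Real.pi) * s)) :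
    circlePairing a (tangentialDeriv a) = -(2 * I) * s := by
  rw [circlePairing]
  simp only [coeff_mul_conj_tangentialDeriv]
  rw [tsum_mul_left, ← Complex.ofReal_tsum, h.tsum_eq]
  have hpi : (Real.pi : ℂ) ≠ 0 := by exact_mod_cast Real.pi_ne_zero
  push_cast
  field_simp

/-- The boundary term of the energy identity, in terms of the integrals over `Ω`. -/
lemma boundaryTerm_eq {g : ℕ → L2Circle} {s : ℕ → ℝ}
    (h : ∀ m, HasSum (fun n : ℤ => (n : ℝ) * ‖coeff (g m) n‖ ^ 2) ((1 / Real.pi) * s m))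
    (hs : Summable fun p => s (doubleIndex p)) :
    I / 2 * boundaryTerm g = ((∑' p, s (doubleIndex p) : ℝ) : ℂ) := by
  have e : ∀ j k : ℕ, circlePairing ((leftShift^[2 * j] fun k => coeff (g k)) k)
      ((leftShift^[2 * j] fun k => tangentialDeriv (coeff (g k))) k) =
      -(2 * I) * (s (doubleIndex (j, k)) : ℂ) := by
    intro j k
    simp only [leftShift_iterate]
    exact circlePairing_tangentialDeriv (h _)
  simp only [boundaryTerm, seqPairing, e]
  have hs' : Summable fun p => (s (doubleIndex p) : ℂ) := Complex.summable_ofReal.2 hs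
  rw [Complex.ofReal_tsum, hs'.tsum_prod]
  simp only [tsum_mul_left]
  linear_combination (-(∑' (j : ℕ) (k : ℕ), (s (doubleIndex (j, k)) : ℂ))) * Complex.I_sq

/-- Each term has modulus `|n| |gₙ|²`, so Tonelli reduces the triple series to `H^{1/2}` norms
summed over pairs. -/
lemma boundaryConverges_of_summable {g : ℕ → L2Circle} {b : ℕ → ℝ}
    (h : ∀ m, Summable fun n : ℤ => (1 + |(n : ℝ)|) * ‖coeff (g m) n‖ ^ 2)
    (hb : ∀ m, ∑' n : ℤ, (1 + |(n : ℝ)|) * ‖coeff (g m) n‖ ^ 2 ≤ b m)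
    (hs : Summable fun p => b (doubleIndex p)) : BoundaryConverges g := by
  have h1 : Summable fun q : (ℕ × ℕ) × ℤ =>
      (1 + |(q.2 : ℝ)|) * ‖coeff (g (doubleIndex q.1)) q.2‖ ^ 2 := by
    rw [summable_prod_of_nonneg fun _ => by positivity]
    exact ⟨fun p => h (doubleIndex p), Summable.of_nonneg_of_le
      (fun p => tsum_nonneg fun _ => by positivity) (fun p => hb (doubleIndex p)) hs⟩
  have h2 := (Equiv.prodAssoc ℕ ℕ ℤ).symm.summable_iff.2 h1
  refine Summable.of_norm_bounded h2 fun q => ?_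
  simp only [leftShift_iterate]
  rw [coeff_mul_conj_tangentialDeriv, norm_mul, norm_neg, Complex.norm_I, one_mul,
    Complex.norm_real, norm_mul, Real.norm_eq_abs, Real.norm_of_nonneg (sq_nonneg _)]
  simp only [Function.comp_apply, Equiv.prodAssoc_symm_apply, doubleIndex]
  gcongr
  linarith

lemma memSeqHalf_of_summable {g : ℕ → L2Circle} {b : ℕ → ℝ}
    (h : ∀ m, Summable fun n : ℤ => (1 + |(n : ℝ)|) * ‖coeff (g m) n‖ ^ 2)
    (hb : ∀ m, ∑' n : ℤ, (1 + |(n : ℝ)|) * ‖coeff (g m) n‖ ^ 2 ≤ b m)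
    (hs : Summable fun m : ℕ => (1 + (m : ℝ)) * b m) : MemSeqHalf (1 / 2) g := by
  have hle : ∀ m (n : ℤ), (1 + (n : ℝ) ^ 2) ^ (1 / 2 : ℝ) * ‖coeff (g m) n‖ ^ 2 ≤
      (1 + |(n : ℝ)|) * ‖coeff (g m) n‖ ^ 2 := fun m n =>
    mul_le_mul_of_nonneg_right (rpow_half_le_one_add _) (sq_nonneg _)
  have h1 : ∀ m, Summable fun n : ℤ => (1 + (n : ℝ) ^ 2) ^ (1 / 2 : ℝ) * ‖coeff (g m) n‖ ^ 2 :=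
    fun m => Summable.of_nonneg_of_le (fun n => by positivity) (hle m) (h m)
  refine ⟨h1, Summable.of_nonneg_of_le (fun m => mul_nonneg (by positivity)
    (tsum_nonneg fun n => by positivity)) (fun m => ?_) hs⟩
  have h2 := rpow_half_le_one_add (m : ℝ)
  rw [abs_of_nonneg (Nat.cast_nonneg m)] at h2
  exact mul_le_mul h2 (((h1 m).tsum_le_tsum (hle m) (h m)).trans (hb m))
    (tsum_nonneg fun n => by positivity) (by positivity)

/-! ### The energy identity -/

/-- For `b = (Bv)_m`, `f = f_m`, `d = ∂v_{m+2}` this expands `‖∂̄v_m‖²`. The inner products match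
the five series; `‖d‖²` is kept for telescoping. -/
lemma norm_sq_add_sub (b f d : L2Disc) :
    ‖b + f - d‖ ^ 2 = (inner ℂ b b : ℂ).re + (inner ℂ f f : ℂ).re + ‖d‖ ^ 2
      + 2 * (inner ℂ b f : ℂ).re - 2 * (inner ℂ d b : ℂ).re - 2 * (inner ℂ d f : ℂ).re := by
  have h1 := norm_sub_sq (𝕜 := ℂ) (b + f) d
  have h2 := norm_add_sq (𝕜 := ℂ) b f
  have h3 := inner_self_eq_norm_sq (𝕜 := ℂ) b
  have h4 := inner_self_eq_norm_sq (𝕜 := ℂ) f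
  have h5 := inner_re_symm (𝕜 := ℂ) b d
  have h6 := inner_re_symm (𝕜 := ℂ) f d
  rw [inner_add_left, map_add] at h1
  simp only [RCLike.re_to_complex] at *
  linarith

end BukhgeimBeltrami

end

theorem theorem4p1 (f : SeqL2) (hf : MemSeqL2 1 f)
    (B : SeqL2 →ₗ[ℂ] SeqL2) (hB₀ : IsBoundedL2 B) (hB₁ : IsBoundedH1 B)
    (v : SeqL2) (hv : MemSeqH1 (1 / 2) v)
    (heq : dzbarSeq v + leftShift^[2] (dzSeq v) = ⇑(B v) + ⇑f) :
    -- every expression in the identity makes sense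
    (∀ᵐ z ∂discMeasure, Memℓp (evalAt (dzSeq v) z) 2 ∧ Memℓp (evalAt (B v) z) 2 ∧
      Memℓp (evalAt f z) 2) ∧
    Integrable (fun z => l2NormSq (evalAt (dzSeq v) z)) discMeasure ∧
    Converges (crossTerm v (B v)) ∧ Converges (squareTerm (B v)) ∧
    Converges (crossTerm v f) ∧ Converges (innerTerm (B v) f) ∧ Converges (squareTerm f) ∧
    -- `g` is the trace of `v` on the boundary
    ∃ g : ℕ → L2Circle, (∀ j h, IsTrace (v j) h ↔ h = g j) ∧
      MemSeqHalf (1 / 2) g ∧ BoundaryConverges g ∧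
      -- the energy identity
      ((∫ z in disc, l2NormSq (evalAt (dzSeq v) z) : ℝ) : ℂ) =
        ((-2 * integralSum (crossTerm v (B v)) + integralSum (squareTerm (B v))
          - 2 * integralSum (crossTerm v f) + 2 * integralSum (innerTerm (B v) f)
          + integralSum (squareTerm f) : ℝ) : ℂ)
        + I / 2 * boundaryTerm g := by
  obtain ⟨C, hC⟩ := hB₀
  have hD : HalfSummable (dzSeq v) := .of_le_h1NormSq hv fun m => norm_sq_dz_le _
  have hDb : HalfSummable (dzbarSeq v) := .of_le_h1NormSq hv fun m => norm_sq_dzbar_le _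
  have hF : HalfSummable f := halfSummable_of_memSeqL2_one hf
  have hB : HalfSummable (B v) := halfSummable_of_memSeqL2_one (hC v).1
  obtain ⟨mD, iD, sD⟩ := hasSum_integral_l2NormSq hD.summable
  obtain ⟨mB, -, -⟩ := hasSum_integral_l2NormSq hB.summable
  obtain ⟨mF, -, -⟩ := hasSum_integral_l2NormSq hF.summable
  simp only [crossTerm_eq, squareTerm_eq]
  obtain ⟨c1, s1⟩ := converges_innerTerm (hD.shift 2) hB
  obtain ⟨c2, s2⟩ := converges_innerTerm hB hB
  obtain ⟨c3, s3⟩ := converges_innerTerm (hD.shift 2) hF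
  obtain ⟨c4, s4⟩ := converges_innerTerm hB hF
  obtain ⟨c5, s5⟩ := converges_innerTerm hF hF
  choose g hg1 hg2 hg3 hg4 using fun m => exists_trace (v m) (hv.1 m)
  -- The constant `11 = 3 + 4 + 4` collects the three terms of the trace inequality.
  have hg3' : ∀ m, ∑' n : ℤ, (1 + |(n : ℝ)|) * ‖coeff (g m) n‖ ^ 2 ≤
      (1 / (2 * Real.pi) * 11) * h1NormSq (v m) := by
    intro m
    refine (hg3 m).trans ?_
    rw [mul_assoc]
    refine mul_le_mul_of_nonneg_left ?_ (by positivity)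
    have h1 := norm_sq_dz_le (v m)
    have h2 := norm_sq_dzbar_le (v m)
    have h3 : ‖v m‖ ^ 2 ≤ h1NormSq (v m) := by
      rw [h1NormSq]; nlinarith [sq_nonneg ‖weakDeriv 1 (v m)‖, sq_nonneg ‖weakDeriv I (v m)‖]
    linarith
  have hbs : Summable fun m : ℕ => (1 + (m : ℝ)) * ((1 / (2 * Real.pi) * 11) * h1NormSq (v m)) :=
    (hv.summable.mul_left (1 / (2 * Real.pi) * 11)).congr fun m => by ring
  have sDp := hD.doubleIndex
  have sDbp := hDb.doubleIndex
  have sD2 := (hD.shift 2).doubleIndex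
  refine ⟨?_, iD, c1, c2, c3, c4, c5, g, hg1, memSeqHalf_of_summable hg2 hg3' hbs,
    boundaryConverges_of_summable hg2 hg3' (summable_doubleIndex
      (a := fun m => (1 / (2 * Real.pi) * 11) * h1NormSq (v m))
      (fun m => mul_nonneg (by positivity) (h1NormSq_nonneg _)) hbs), ?_⟩
  · filter_upwards [mD, mB, mF] with z h1 h2 h3
    exact ⟨h1, h2, h3⟩
  rw [boundaryTerm_eq (s := fun m => ‖dz (v m)‖ ^ 2 - ‖dzbar (v m)‖ ^ 2) hg4 (sDp.sub sDbp),
    ← Complex.ofReal_add]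
  congr 1
  have hDbar : ∀ m, dzbarSeq v m = (B v : ℕ → L2Disc) m + f m - leftShift^[2] (dzSeq v) m :=
    fun m => eq_sub_of_add_eq (congrFun heq m)
  have hexp := fun p : ℕ × ℕ => norm_sq_add_sub ((B v : ℕ → L2Disc) (doubleIndex p))
    (f (doubleIndex p)) (leftShift^[2] (dzSeq v) (doubleIndex p))
  simp only [← hDbar] at hexp
  -- The expansion summed over pairs: `∑ ‖∂̄v‖²` equals the five integrals, with signs, plus `∑
  -- ‖∂v_{m+2}‖²`.
  have hbar := (((((s2.add s5).add sD2.hasSum).add (s4.mul_left 2)).sub (s1.mul_left 2)).sub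
    (s3.mul_left 2)).tsum_eq
  simp only [← hexp] at hbar
  have htel := tsum_doubleIndex_sub (a := fun m => ‖dzSeq v m‖ ^ 2) sDp
  have hsub : ∑' p, (‖dz (v (doubleIndex p))‖ ^ 2 - ‖dzbar (v (doubleIndex p))‖ ^ 2) =
      ∑' p, ‖dzSeq v (doubleIndex p)‖ ^ 2 - ∑' p, ‖dzbarSeq v (doubleIndex p)‖ ^ 2 :=
    sDp.tsum_sub sDbp
  have hsh : ∑' p, ‖leftShift^[2] (dzSeq v) (doubleIndex p)‖ ^ 2 =
      ∑' p, ‖dzSeq v (doubleIndex p + 2)‖ ^ 2 := by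
    simp only [leftShift_iterate]
  rw [hsub, hbar, hsh, ← sD.tsum_eq]
  linarith
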